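/- **Definitions (general).** Let $\mathcal E$ be a category with finite products, an initial object and the limits and colimits used below, and let $\top:1\to\Delta$ be a map in $\mathcal E$. A map $m:A'\to A$ is *semidecidable* if it is a pullback of $\top$ along some $A\to\Delta$. The map $\top$ is a *generic semidecidable subobject* if every semidecidable $m:A'\to A$ is the pullback of $\top$ along exactly one map $A\to\Delta$, every $0\to A$ is semidecidable, and semidecidable maps are closed under composition. Its *lifting functor* $L$, with unit $\eta$, is given by partial map classifiers: every $\eta_B:B\to LB$ is semidecidable; for every semidecidable $m:A'\to A$ and every $g:A'\to B$ there is exactly one $h:A\to LB$ such that $(m,g)$ is a pullback of $(h,\eta_B)$; and for $f:A\to B$ the map $Lf$ is the one for which $(\eta_A,f)$ is a pullback of $(Lf,\eta_B)$. The point $\bot:1\to L1$ classifies the partial map $1\rightharpoonup 1$ with domain $0$. Let $\omega=\operatorname{colim}(1\xrightarrow{\bot}L1\xrightarrow{L\bot}L^21\to\cdots)$ and $\bar\omega=\lim(1\xleftarrow{!}L1\xleftarrow{L!}L^21\leftarrow\cdots)$, and let $i:\omega\to\bar\omega$ be the canonical map, with components $L^m1\to L^n1$ the composites of the maps $L^k(\bot)$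 if $m\le n$ and of the maps $L^k(!)$ if $m\ge n$. An object $X$ is *$L$-complete* if it is right-orthogonal to $\mathrm{id}_A\times i:A\times\omega\to A\times\bar\omega$ for every $A$, i.e. every map $A\times\omega\to X$ factors through $\mathrm{id}_A\times i$ in exactly one way. A *normal model* of $\mathsf{PCF_v}$ is a Grothendieck topos $\mathcal E$ with a generic semidecidable subobject $\top:1\to\Delta$ such that $L(\sum_0^\infty 1)$ is $L$-complete for the lifting functor $L$ of $\top$. **Definitions (the site).** A *system of partitions* on a finite set $w$ is a set $S^w$ of sets of pairwise disjoint nonempty subsets of $w$ such that $\emptyset\in S^w$ and $\{w\}\setminus\{\emptyset\}\in S^w$; if $P,Q\in S^w$ and $U\in P$ then $(P\setminus\{U\})\cup(\{U\cap V\mid V\in Q\}\setminus\{\emptyset\})\in S^w$; and if $U,V\in P\in S^w$ then $(P\setminus\{U,V\})\cup\{U\cup V\}\in S^w$. The category $\mathsf{SSP}_\bot$ has these as objects; a morphism $(v,S^v)\to(w,S^w)$ is a partial function $f:v\rightharpoonup w$ such that $\{f^{-1}(U)\mid U\in P\}\setminus\{\emptyset\}\in S^v$ for all $P\in S^w$.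 The site $(\mathcal I,\mathcal J)$ is the sum, identifying terminal objects, of the following concrete sites: the site $\mathbb V$, and the site $(\mathcal I_{\mathcal C,F},\mathcal J_{\mathcal C,F})$ for every category $\mathcal C$ with countably many morphisms and every faithful functor $F:\mathcal C\to\mathsf{SSP}_\bot$. Explicitly, its objects are a terminal object $\star$, with $|\star|=\{*\}$; an object $\mathrm V$, with $|\mathrm V|=\{0\le 1\le\cdots\le\infty\}$; and, for all $(\mathcal C,F)$ as above, the pairs $(c,U)$ with $c\in\mathcal C$ and $U=\bigcup P$ for some $P\in S^{F(c)}$, with $|(c,U)|=U$. Its morphisms $X\to Y$ are the following functions $|X|\to|Y|$: all constant functions; for $X=Y=\mathrm V$, also the Scott-continuous functions; for $X=(c,U)$ and $Y=(d,V)$ belonging to the same $(\mathcal C,F)$, also the functions $f:U\to V$ for which there is $\phi:c\to d$ in $\mathcal C$ such that $F(\phi)$ is defined on all of $U$ and restricts to $f$. The objects $\star$ and $\mathrm V$ are covered by their identities only; the covers of $(c,U)$ are the families of inclusions $\{(c,U_k)\to(c,U)\}_{1\le k\le n}$ with $\{U_1,\dots,U_n\}\in S^{F(c)}$ and $\bigcup_k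 U_k=U$. Let $\mathcal G=\mathrm{Sh}(\mathcal I,\mathcal J)$. Let $\Delta_{\mathcal G}$ be the sheaf of subsets $U'\subseteq|X|$ of the following form, restricted by preimage: all subsets if $X=\star$; $\emptyset$ and the sets $\{n,n+1,\dots,\infty\}$ with $n\in\mathbb N$ if $X=\mathrm V$; those $U'\subseteq U$ for which $(c,U')$ is an object if $X=(c,U)$. Let $\top:1\to\Delta_{\mathcal G}$ be given by $|X|\subseteq|X|$. For a sheaf $A$ let $(L_{\mathcal G}A)(X)$ be the set of pairs of an element $p\in\Delta_{\mathcal G}(X)$ and a compatible family of elements of $A$ on the sieve of all $f:Y\to X$ with $f^{-1}(p)=|Y|$. **Statement.** $L_{\mathcal G}$, with the evident unit and point $\bot$, is the lifting functor of $\top:1\to\Delta_{\mathcal G}$, and, with $N_{\mathcal G}=\sum_0^\infty1$, the object $L_{\mathcal G}(N_{\mathcal G})$ is $L_{\mathcal G}$-complete: it is right-orthogonal to $\mathrm{id}_A\times i:A\times\omega\to A\times\bar\omega$ for every $A\in\mathcal G$. Moreover, $\top:1\to\Delta_{\mathcal G}$ is a generic semidecidable subobject, and hence $(\mathcal G,\top:1\to\Delta_{\mathcal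 G})$ is a normal model of $\mathsf{PCF_v}$. -/

import Mathlib

open CategoryTheory Limits MonoidalCategory CartesianMonoidalCategory Opposite

namespace PCFv

universe v u v₁ u₁

noncomputable section

section Abstract

variable {E : Type u} [Category.{v} E] [CartesianMonoidalCategory E]

/-- A map is semidecidable for `t : 1 ⟶ Δ` if it is a pullback of `t`
(`t`, having terminal domain, is automatically a monomorphism, and so is any pullback of it). -/
def IsSemidecidable {Δ : E} (t : 𝟙_ E ⟶ Δ) {A' A : E} (m : A' ⟶ A) : Prop :=
  ∃ φ : A ⟶ Δ, IsPullback m (toUnit A') φ t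

/-- `t : 1 ⟶ Δ` is a generic semidecidable subobject. -/
structure IsGenericSemidecidable [HasInitial E] {Δ : E} (t : 𝟙_ E ⟶ Δ) : Prop where
  existsUnique_classifier : ∀ {A' A : E} (m : A' ⟶ A), IsSemidecidable t m →
    ∃! φ : A ⟶ Δ, IsPullback m (toUnit A') φ t
  initial_to : ∀ A : E, IsSemidecidable t (initial.to A)
  comp : ∀ {A'' A' A : E} (n : A'' ⟶ A') (m : A' ⟶ A),
    IsSemidecidable t n → IsSemidecidable t m → IsSemidecidable t (n ≫ m)

/-- `L`, with unit `η`, is the lifting functor of `t`: each `η_B : B ⟶ L B` is the classifier of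
partial maps with semidecidable domain, and `L` acts on maps accordingly: `L f` classifies the
partial map with domain `η_A : A ⟶ L A` and values `f`. These conditions determine `(L, η)` up to
a unique isomorphism. -/
structure IsLifting {Δ : E} (t : 𝟙_ E ⟶ Δ) (L : E ⥤ E) (η : 𝟭 E ⟶ L) : Prop where
  semidecidable : ∀ B : E, IsSemidecidable t (η.app B)
  existsUnique_classifier : ∀ {A' A B : E} (m : A' ⟶ A) (g : A' ⟶ B), IsSemidecidable t m →
    ∃! h : A ⟶ L.obj B, IsPullback m g h (η.app B)
  isPullback_map : ∀ {A B : E} (f : A ⟶ B), IsPullback (η.app A) f (L.map f) (η.app B)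

/-- `b : 1 ⟶ L 1` is the point `⊥` of the lifting functor: it classifies the partial map
`1 ⇀ 1` with empty domain. -/
def IsBottom [HasInitial E] {L : E ⥤ E} (η : 𝟭 E ⟶ L) (b : 𝟙_ E ⟶ L.obj (𝟙_ E)) : Prop :=
  IsPullback (initial.to (𝟙_ E)) (initial.to (𝟙_ E)) b (η.app (𝟙_ E))

variable (L : E ⥤ E) (b : 𝟙_ E ⟶ L.obj (𝟙_ E))

/-- `Lⁿ 1`. -/
def liftPow : ℕ → E
  | 0 => 𝟙_ E
  | n + 1 => L.obj (liftPow n)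

/-- The maps `Lⁿ(!) : Lⁿ⁺¹ 1 ⟶ Lⁿ 1`. -/
def collapse : ∀ n : ℕ, liftPow L (n + 1) ⟶ liftPow L n
  | 0 => toUnit _
  | n + 1 => L.map (collapse n)

/-- The maps `Lⁿ(⊥) : Lⁿ 1 ⟶ Lⁿ⁺¹ 1`. -/
def extend : ∀ n : ℕ, liftPow L n ⟶ liftPow L (n + 1)
  | 0 => b
  | n + 1 => L.map (extend n)

/-- The comparison maps `Lᵐ 1 ⟶ Lⁿ 1`: the composite of the maps `extend` if `m ≤ n`
(see `compare_self`, `compare_succ_right`) and of the maps `collapse` if `n ≤ m`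
(see `compare_self`, `compare_succ_left`). -/
def compare : ∀ m n : ℕ, liftPow L m ⟶ liftPow L n
  | _, 0 => toUnit _
  | 0, n + 1 => b ≫ L.map (compare 0 n)
  | m + 1, n + 1 => L.map (compare m n)

theorem compare_self : ∀ n : ℕ, compare L b n n = 𝟙 _
  | 0 => toUnit_unique _ _
  | n + 1 => (congrArg L.map (compare_self n)).trans (L.map_id _)

theorem compare_succ_right : ∀ m n : ℕ, m ≤ n →
    compare L b m (n + 1) = compare L b m n ≫ extend L b n
  | 0, 0, _ => by
    have h : compare L b 0 0 = 𝟙 (𝟙_ E) := toUnit_unique _ _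
    have h₁ : b ≫ L.map (𝟙 (𝟙_ E)) = b :=
      (congrArg (fun k => b ≫ k) (L.map_id _)).trans (Category.comp_id _)
    have h₂ : b = 𝟙 (𝟙_ E) ≫ b := (Category.id_comp _).symm
    exact (congrArg (fun k => b ≫ L.map k) h).trans
      (h₁.trans (h₂.trans (congrArg (fun k => k ≫ b) h.symm)))
  | 0, n + 1, _ =>
    (congrArg (fun k => b ≫ L.map k) (compare_succ_right 0 n (Nat.zero_le _))).trans
      ((congrArg (fun k => b ≫ k) (L.map_comp _ _)).trans (Category.assoc _ _ _).symm)
  | m + 1, n + 1, h =>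
    (congrArg L.map (compare_succ_right m n (Nat.le_of_succ_le_succ h))).trans (L.map_comp _ _)

theorem compare_succ_left : ∀ m n : ℕ, n ≤ m →
    compare L b (m + 1) n = collapse L m ≫ compare L b m n
  | _, 0, _ => toUnit_unique _ _
  | m + 1, n + 1, h =>
    (congrArg L.map (compare_succ_left m n (Nat.le_of_succ_le_succ h))).trans (L.map_comp _ _)

theorem extend_compare : ∀ m n : ℕ, extend L b m ≫ compare L b (m + 1) n = compare L b m n
  | _, 0 => toUnit_unique _ _
  | 0, _ + 1 => rfl
  | m + 1, n + 1 => (L.map_comp _ _).symm.trans (congrArg L.map (extend_compare m n))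

theorem compare_collapse : ∀ m n : ℕ, compare L b m (n + 1) ≫ collapse L n = compare L b m n
  | _, 0 => toUnit_unique _ _
  | 0, n + 1 =>
    (Category.assoc _ _ _).trans (congrArg (fun k => b ≫ k)
      ((L.map_comp _ _).symm.trans (congrArg L.map (compare_collapse 0 n))))
  | m + 1, n + 1 => (L.map_comp _ _).symm.trans (congrArg L.map (compare_collapse m n))

/-- The finite vertical natural numbers `ω`: the colimit of `1 ⟶ L 1 ⟶ L L 1 ⟶ ⋯`. -/
def omega [HasColimitsOfShape ℕ E] : E := colimit (Functor.ofSequence (extend L b))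

/-- The extended vertical natural numbers `ω̄`: the limit of `1 ⟵ L 1 ⟵ L L 1 ⟵ ⋯`. -/
def omegaBar [HasLimitsOfShape ℕᵒᵖ E] : E := limit (Functor.ofOpSequence (collapse L))

/-- The map `Lᵐ 1 ⟶ ω̄` with components `compare m n`. -/
def toOmegaBar [HasLimitsOfShape ℕᵒᵖ E] (m : ℕ) : liftPow L m ⟶ omegaBar L :=
  limit.lift (Functor.ofOpSequence (collapse L))
    { pt := liftPow L m
      π := NatTrans.ofOpSequence (fun n => compare L b m n) (fun n => by
        rw [Functor.ofOpSequence_map_homOfLE_succ]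
        exact (Category.id_comp _).trans (compare_collapse L b m n).symm) }

theorem toOmegaBar_π [HasLimitsOfShape ℕᵒᵖ E] (m : ℕ) (n : ℕᵒᵖ) :
    toOmegaBar L b m ≫ limit.π (Functor.ofOpSequence (collapse L)) n = compare L b m n.unop :=
  limit.lift_π _ _

/-- The canonical comparison `i : ω ⟶ ω̄`. -/
def omegaInclusion [HasColimitsOfShape ℕ E] [HasLimitsOfShape ℕᵒᵖ E] :
    omega L b ⟶ omegaBar L :=
  colimit.desc (Functor.ofSequence (extend L b))
    { pt := omegaBar L
      ι := NatTrans.ofSequence (fun m => toOmegaBar L b m) (fun m => by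
        rw [Functor.ofSequence_map_homOfLE_succ]
        refine Eq.trans ?_ (Category.comp_id _).symm
        refine limit.hom_ext fun n => ?_
        refine (Category.assoc _ _ _).trans ?_
        refine (congrArg (fun k => extend L b m ≫ k) (toOmegaBar_π L b (m + 1) n)).trans ?_
        exact (extend_compare L b m n.unop).trans (toOmegaBar_π L b m n).symm) }

/-- `X` is `L`-complete: it is right-orthogonal to `A × i : A × ω ⟶ A × ω̄` for every `A`. -/
def IsComplete [HasColimitsOfShape ℕ E] [HasLimitsOfShape ℕᵒᵖ E] (X : E) : Prop :=
  ∀ (A : E) (f : A ⊗ omega L b ⟶ X),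
    ∃! g : A ⊗ omegaBar L ⟶ X, (A ◁ omegaInclusion L b) ≫ g = f

end Abstract

/-- `E` is a Grothendieck topos: it is equivalent to the category of sheaves of sets on a small
site. (Sets are elements of `Type (max u v)`, so a site with objects in `Type u` and maps in
`Type v` is small.) -/
def IsGrothendieckTopos (E : Type u₁) [Category.{v₁} E] : Prop :=
  ∃ (C : Type u) (_ : Category.{v} C) (J : GrothendieckTopology C),
    Nonempty (E ≌ Sheaf J (Type (max u v)))

section SheafLifting

variable {C : Type 1} [Category.{0} C] {J : GrothendieckTopology C}
  {Δ : Sheaf J (Type 1)} (t : 𝟙_ (Sheaf J (Type 1)) ⟶ Δ)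

/-- The truth value `p ∈ Δ(X)` is true: it is the value of the point `t : 1 ⟶ Δ`. -/
def Holds {X : C} (p : Δ.obj.obj (op X)) : Prop :=
  ∃ u, t.hom.app (op X) u = p

variable {t} in
theorem Holds.map {X Y : C} {p : Δ.obj.obj (op X)} (h : Holds t p) (f : Y ⟶ X) :
    Holds t (Δ.obj.map f.op p) := by
  obtain ⟨u, rfl⟩ := h
  exact ⟨(𝟙_ (Sheaf J (Type 1))).obj.map f.op u, NatTrans.naturality_apply t.hom f.op u⟩

/-- An element of `(L A)(X)`: a truth value `dom ∈ Δ(X)` and a compatible family of elements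
of `A` on the sieve `{f : Y ⟶ X | dom · f is true}`, i.e. a partial map `y(X) ⇀ A`. -/
structure PartialSection (A : Sheaf J (Type 1)) (X : C) : Type 1 where
  dom : Δ.obj.obj (op X)
  val : ∀ {Y : C} (f : Y ⟶ X), Holds t (Δ.obj.map f.op dom) → A.obj.obj (op Y)
  map_val : ∀ {Y Z : C} (f : Y ⟶ X) (g : Z ⟶ Y) (h : Holds t (Δ.obj.map f.op dom))
    (h' : Holds t (Δ.obj.map (g ≫ f).op dom)), A.obj.map g.op (val f h) = val (g ≫ f) h'

namespace PartialSection

variable {t}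

theorem ext' {A : Sheaf J (Type 1)} {X : C} {s s' : PartialSection t A X}
    (hd : s.dom = s'.dom)
    (hv : ∀ {Y : C} (f : Y ⟶ X) (h : Holds t (Δ.obj.map f.op s.dom))
      (h' : Holds t (Δ.obj.map f.op s'.dom)), s.val f h = s'.val f h') : s = s' := by
  obtain ⟨d, v, m⟩ := s
  obtain ⟨d', v', m'⟩ := s'
  obtain rfl : d = d' := hd
  have : @v = @v' := by
    funext Y f h
    exact hv f h h
  subst this
  rfl

theorem val_congr {A : Sheaf J (Type 1)} {X : C} (s : PartialSection t A X) {Y : C}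
    {f f' : Y ⟶ X} (e : f = f') (h : Holds t (Δ.obj.map f.op s.dom))
    (h' : Holds t (Δ.obj.map f'.op s.dom)) : s.val f h = s.val f' h' := by
  subst e; rfl

theorem val_congr' {A : Sheaf J (Type 1)} {X : C} {s s' : PartialSection t A X} (e : s = s')
    {Y : C} {f : Y ⟶ X} (h : Holds t (Δ.obj.map f.op s.dom))
    (h' : Holds t (Δ.obj.map f.op s'.dom)) : s.val f h = s'.val f h' := by
  subst e; rfl

theorem map_comp_apply (F : Cᵒᵖ ⥤ Type 1) {X Y Z : C} (f : Y ⟶ X) (g : Z ⟶ Y)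
    (x : F.obj (op X)) : F.map (g ≫ f).op x = F.map g.op (F.map f.op x) := by
  rw [op_comp, F.map_comp]; rfl

/-- Restriction along `g : Y ⟶ X`. -/
def restrict {A : Sheaf J (Type 1)} {X Y : C} (g : Y ⟶ X) (s : PartialSection t A X) :
    PartialSection t A Y where
  dom := Δ.obj.map g.op s.dom
  val f h := s.val (f ≫ g) (by rwa [map_comp_apply])
  map_val f k h h' := by
    rw [s.map_val (f ≫ g) k _ (by rw [← Category.assoc, map_comp_apply]; exact h')]
    exact s.val_congr (Category.assoc _ _ _).symm _ _

/-- Postcomposition with `φ : A ⟶ B`. -/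
def postcomp {A B : Sheaf J (Type 1)} (φ : A ⟶ B) {X : C} (s : PartialSection t A X) :
    PartialSection t B X where
  dom := s.dom
  val f h := φ.hom.app _ (s.val f h)
  map_val f g h h' := by
    rw [← s.map_val f g h h']
    exact (NatTrans.naturality_apply φ.hom g.op (s.val f h)).symm

/-- The totally defined partial section given by `a ∈ A(X)`. -/
def total {A : Sheaf J (Type 1)} {X : C} (a : A.obj.obj (op X)) : PartialSection t A X where
  dom := t.hom.app (op X) PUnit.unit
  val f _ := A.obj.map f.op a
  map_val f g _ _ := (map_comp_apply A.obj f g a).symm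

end PartialSection

/-- The presheaf `X ↦ (L A)(X)`. -/
def liftPresheaf (A : Sheaf J (Type 1)) : Cᵒᵖ ⥤ Type 1 where
  obj X := PartialSection t A X.unop
  map g := ↾(PartialSection.restrict g.unop)
  map_id X := by
    ext s
    refine PartialSection.ext' ?_ ?_
    · exact Δ.obj.map_id_apply X s.dom
    · intro Y f h h'
      exact s.val_congr (Category.comp_id f) _ _
  map_comp {X Y Z} f g := by
    ext s
    refine PartialSection.ext' ?_ ?_
    · exact PartialSection.map_comp_apply Δ.obj f.unop g.unop s.dom
    · intro W k h h'
      exact s.val_congr (Category.assoc k g.unop f.unop).symm _ _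

theorem liftPresheaf_isSheaf (A : Sheaf J (Type 1)) :
    Presheaf.IsSheaf J (liftPresheaf t A) := by
  have hA := (isSheaf_iff_isSheaf_of_type J A.obj).1 A.property
  have hΔ := (isSheaf_iff_isSheaf_of_type J Δ.obj).1 Δ.property
  rw [isSheaf_iff_isSheaf_of_type]
  intro X S hS
  rw [← Presieve.isSeparatedFor_and_exists_isAmalgamation_iff_isSheafFor]
  constructor
  · intro x s s' hs hs'
    have hd : s.dom = s'.dom := by
      refine ((hΔ S hS).isSeparatedFor).ext fun Y f hf => ?_
      exact congrArg PartialSection.dom ((hs f hf).trans (hs' f hf).symm)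
    refine PartialSection.ext' hd ?_
    intro Y f h h'
    refine ((hA (S.pullback f) (J.pullback_stable f hS)).isSeparatedFor).ext fun Z g hg => ?_
    have k : Holds t (Δ.obj.map (g ≫ f).op s.dom) := by
      rw [PartialSection.map_comp_apply]; exact h.map g
    have k' : Holds t (Δ.obj.map (g ≫ f).op s'.dom) := hd ▸ k
    rw [s.map_val f g h k, s'.map_val f g h' k']
    have e : PartialSection.restrict (g ≫ f) s = PartialSection.restrict (g ≫ f) s' :=
      (hs (g ≫ f) hg).trans (hs' (g ≫ f) hg).symm
    have l : ∀ (r : PartialSection t A X) (q : Holds t (Δ.obj.map (g ≫ f).op r.dom))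
        (q' : Holds t (Δ.obj.map (𝟙 Z).op (Δ.obj.map (g ≫ f).op r.dom))),
        r.val (g ≫ f) q = (PartialSection.restrict (g ≫ f) r).val (𝟙 Z) q' := fun r q q' =>
      r.val_congr (Category.id_comp _).symm _ _
    have q : Holds t (Δ.obj.map (𝟙 Z).op (Δ.obj.map (g ≫ f).op s.dom)) := by
      rw [← PartialSection.map_comp_apply, Category.id_comp]; exact k
    have q' : Holds t (Δ.obj.map (𝟙 Z).op (Δ.obj.map (g ≫ f).op s'.dom)) := hd ▸ q
    rw [l s k q, l s' k' q']
    exact PartialSection.val_congr' e _ _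
  · intro x hx
    have hres : ∀ {Y Z : C} (f : Y ⟶ X) (hf : S f) (g : Z ⟶ Y) (f' : Z ⟶ X) (hf' : S f')
        (_ : f' = g ≫ f), PartialSection.restrict g (x f hf) = x f' hf' := by
      intro Y Z f hf g f' hf' e
      subst e
      have := hx g (𝟙 Z) hf hf' (Category.id_comp _).symm
      exact this.trans ((liftPresheaf t A).map_id_apply _ _)
    have hval : ∀ {Y Z : C} (f : Y ⟶ X) (hf : S f) (g : Z ⟶ Y) (f' : Z ⟶ X) (hf' : S f')
        (_ : f' = g ≫ f) (q : Holds t (Δ.obj.map (𝟙 Z).op (x f' hf').dom))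
        (q' : Holds t (Δ.obj.map g.op (x f hf).dom)),
        (x f' hf').val (𝟙 Z) q = (x f hf).val g q' := by
      intro Y Z f hf g f' hf' e q q'
      have e' := hres f hf g f' hf' e
      have q₁ : Holds t (Δ.obj.map (𝟙 Z).op (PartialSection.restrict g (x f hf)).dom) := by
        rw [e']; exact q
      refine (PartialSection.val_congr' e' q₁ q).symm.trans ?_
      exact (x f hf).val_congr (Category.id_comp g) _ _
    let xd : Presieve.FamilyOfElements Δ.obj S.arrows := fun Y f hf => (x f hf).dom
    have hxd : xd.Compatible := by
      intro Y₁ Y₂ Z g₁ g₂ f₁ f₂ h₁ h₂ e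
      exact congrArg PartialSection.dom (hx g₁ g₂ h₁ h₂ e)
    let d : Δ.obj.obj (op X) := (hΔ S hS).amalgamate xd hxd
    have hd : ∀ {Y : C} (f : Y ⟶ X) (hf : S f), Δ.obj.map f.op d = (x f hf).dom :=
      fun f hf => (hΔ S hS).valid_glue hxd f hf
    have hq : ∀ {Y Z : C} (f : Y ⟶ X) (_ : Holds t (Δ.obj.map f.op d)) (g : Z ⟶ Y)
        (hg : S (g ≫ f)), Holds t (Δ.obj.map (𝟙 Z).op (x (g ≫ f) hg).dom) := by
      intro Y Z f h g hg
      rw [← hd (g ≫ f) hg, PartialSection.map_comp_apply]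
      exact (h.map g).map (𝟙 Z)
    let fam : ∀ {Y : C} (f : Y ⟶ X) (_ : Holds t (Δ.obj.map f.op d)),
        Presieve.FamilyOfElements A.obj (S.pullback f).arrows :=
      fun f h Z g hg => (x (g ≫ f) hg).val (𝟙 Z) (hq f h g hg)
    have hfam : ∀ {Y : C} (f : Y ⟶ X) (h : Holds t (Δ.obj.map f.op d)),
        (fam f h).Compatible := by
      intro Y f h Z₁ Z₂ W g₁ g₂ f₁ f₂ h₁ h₂ e
      have hS₁ : S (g₁ ≫ f₁ ≫ f) := S.downward_closed h₁ g₁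
      have e₂ : g₁ ≫ f₁ ≫ f = g₂ ≫ f₂ ≫ f := by
        rw [← Category.assoc, e, Category.assoc]
      have q : Holds t (Δ.obj.map (𝟙 W).op (x (g₁ ≫ f₁ ≫ f) hS₁).dom) := by
        rw [← hd _ hS₁, PartialSection.map_comp_apply Δ.obj (f₁ ≫ f) g₁,
          PartialSection.map_comp_apply Δ.obj f f₁]
        exact ((h.map f₁).map g₁).map _
      have q₁ := (hq f h f₁ h₁).map g₁
      have q₂ := (hq f h f₂ h₂).map g₂
      rw [← PartialSection.map_comp_apply] at q₁ q₂
      have r₁ : Holds t (Δ.obj.map g₁.op (x (f₁ ≫ f) h₁).dom) := by simpa using q₁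
      have r₂ : Holds t (Δ.obj.map g₂.op (x (f₂ ≫ f) h₂).dom) := by simpa using q₂
      change A.obj.map g₁.op ((x (f₁ ≫ f) h₁).val (𝟙 Z₁) _) =
        A.obj.map g₂.op ((x (f₂ ≫ f) h₂).val (𝟙 Z₂) _)
      rw [(x (f₁ ≫ f) h₁).map_val (𝟙 Z₁) g₁ _ q₁, (x (f₂ ≫ f) h₂).map_val (𝟙 Z₂) g₂ _ q₂,
        (x (f₁ ≫ f) h₁).val_congr (Category.comp_id g₁) q₁ r₁,
        (x (f₂ ≫ f) h₂).val_congr (Category.comp_id g₂) q₂ r₂,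
        ← hval (f₁ ≫ f) h₁ g₁ _ hS₁ rfl q r₁, ← hval (f₂ ≫ f) h₂ g₂ _ hS₁ e₂ q r₂]
    let v : ∀ {Y : C} (f : Y ⟶ X), Holds t (Δ.obj.map f.op d) → A.obj.obj (op Y) :=
      fun f h => (hA (S.pullback f) (J.pullback_stable f hS)).amalgamate (fam f h) (hfam f h)
    have hv : ∀ {Y Z : C} (f : Y ⟶ X) (h : Holds t (Δ.obj.map f.op d)) (g : Z ⟶ Y)
        (hg : S (g ≫ f)),
        A.obj.map g.op (v f h) = (x (g ≫ f) hg).val (𝟙 Z) (hq f h g hg) := by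
      intro Y Z f h g hg
      exact (hA (S.pullback f) (J.pullback_stable f hS)).valid_glue (hfam f h) g hg
    refine ⟨⟨d, v, ?_⟩, ?_⟩
    · intro Y Z f g h h'
      refine ((hA (S.pullback (g ≫ f)) (J.pullback_stable _ hS)).isSeparatedFor).ext
        fun W k hk => ?_
      have hk' : S ((k ≫ g) ≫ f) := by rw [Category.assoc]; exact hk
      rw [← PartialSection.map_comp_apply, hv f h (k ≫ g) hk', hv (g ≫ f) h' k hk]
      have q := hq (g ≫ f) h' k hk
      have q' : Holds t (Δ.obj.map (𝟙 W).op (x (k ≫ g ≫ f) hk).dom) := q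
      exact hval (k ≫ g ≫ f) hk (𝟙 W) _ hk' (by simp) _ q'
    · intro Y f hf
      refine PartialSection.ext' (hd f hf) ?_
      intro Z g h h'
      have hg : S (g ≫ f) := S.downward_closed hf g
      have hg' : S (𝟙 Z ≫ g ≫ f) := by rw [Category.id_comp]; exact hg
      have h₁ : Holds t (Δ.obj.map (g ≫ f).op d) := by
        rw [PartialSection.map_comp_apply, hd f hf]; exact h'
      change v (g ≫ f) h₁ = _
      have e := hv (g ≫ f) h₁ (𝟙 Z) hg'
      rw [op_id, Functor.map_id_apply] at e
      exact e.trans (hval f hf g _ hg' (Category.id_comp _) _ h')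

/-- The lifting functor `L` of `t : 1 ⟶ Δ` on a category of sheaves. -/
def liftFunctor : Sheaf J (Type 1) ⥤ Sheaf J (Type 1) where
  obj A := ⟨liftPresheaf t A, liftPresheaf_isSheaf t A⟩
  map φ := ⟨{ app := fun _ => ↾(PartialSection.postcomp φ)
              naturality := fun _ _ _ => rfl }⟩

/-- The unit `η_A : A ⟶ L A`: total elements as partial elements. -/
def liftUnit : 𝟭 (Sheaf J (Type 1)) ⟶ liftFunctor t where
  app A := ⟨{ app := fun _ => ↾(PartialSection.total)
              naturality := by
                intro X Y f
                ext a
                refine PartialSection.ext' ?_ ?_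
                · exact NatTrans.naturality_apply t.hom f PUnit.unit
                · intro Z g h h'
                  exact (PartialSection.map_comp_apply A.obj f.unop g a).symm }⟩
  naturality := by
    intro A B φ
    ext X a
    refine PartialSection.ext' rfl ?_
    intro Y f h h'
    exact (NatTrans.naturality_apply φ.hom f.op a).symm

end SheafLifting

/-! ### Systems of partitions -/

/-- A finite set with a system of partitions: a set `parts` of partial partitions, i.e. of sets of
pairwise disjoint nonempty subsets (the blocks). On the empty set the block `univ` is empty and is
dropped, so `{univ} \ {∅}` is the one-block partition `{univ}` unless the set is empty. -/
structure SSP : Type 1 where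
  carrier : Type
  [finite : Finite carrier]
  parts : Set (Set (Set carrier))
  empty_notMem : ∀ P ∈ parts, ∅ ∉ P
  disjoint : ∀ P ∈ parts, P.PairwiseDisjoint id
  empty_mem : ∅ ∈ parts
  univ_mem : {Set.univ} \ {∅} ∈ parts
  refine_mem : ∀ P ∈ parts, ∀ Q ∈ parts, ∀ U ∈ P,
    (P \ {U}) ∪ (((fun V => U ∩ V) '' Q) \ {∅}) ∈ parts
  merge_mem : ∀ P ∈ parts, ∀ U ∈ P, ∀ V ∈ P, (P \ {U, V}) ∪ {U ∪ V} ∈ parts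

namespace SSP

/-- The semidecidable subsets: the unions of partial partitions. -/
def Semidecidable (w : SSP) (U : Set w.carrier) : Prop := ∃ P ∈ w.parts, U = ⋃₀ P

/-- The preimage of a subset under a partial function. -/
def preim {α β : Type} (f : α → Option β) (U : Set β) : Set α := {x | ∃ y ∈ U, f x = some y}

/-- A morphism in the Kleisli category of the lifting monad on systems of partitions,
equivalently a partial map of systems of partitions: a partial function along which partial
partitions pull back to partial partitions (empty preimages of blocks are dropped). -/
@[ext]
structure PMap (v w : SSP) : Type where
  toFun : v.carrier → Option w.carrier
  preim_mem : ∀ P ∈ w.parts, (preim toFun '' P) \ {∅} ∈ v.parts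

theorem preim_some {α : Type} (U : Set α) : preim (fun x => some x) U = U := by
  ext x; simp [preim]

theorem preim_bind {α β γ : Type} (f : α → Option β) (g : β → Option γ) (U : Set γ) :
    preim (fun x => (f x).bind g) U = preim f (preim g U) := by
  ext x
  simp only [preim, Set.mem_ofPred_eq, Option.bind_eq_some_iff]
  constructor
  · rintro ⟨z, hz, y, hy, hyz⟩
    exact ⟨y, ⟨z, hz, hyz⟩, hy⟩
  · rintro ⟨y, ⟨z, hz, hyz⟩, hy⟩
    exact ⟨z, hz, y, hy, hyz⟩

theorem preim_empty {α β : Type} (f : α → Option β) : preim f ∅ = ∅ := by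
  ext x; simp [preim]

/-- The category `SSP_⊥` of systems of partitions and partial maps. -/
instance : Category.{0} SSP where
  Hom := PMap
  id v := ⟨fun x => some x, fun P hP => by
    have h1 : preim (fun x : v.carrier => some x) '' P = P := by
      rw [show preim (fun x : v.carrier => some x) = id from funext preim_some, Set.image_id]
    rw [h1, Set.sdiff_singleton_eq_self (v.empty_notMem P hP)]
    exact hP⟩
  comp {u v w} f g := ⟨fun x => (f.toFun x).bind g.toFun, fun P hP => by
    have h := f.preim_mem _ (g.preim_mem P hP)
    have e : (preim f.toFun '' ((preim g.toFun '' P) \ {∅})) \ {∅} =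
        (preim (fun x => (f.toFun x).bind g.toFun) '' P) \ {∅} := by
      ext U
      simp only [Set.mem_sdiff, Set.mem_image, Set.mem_singleton_iff]
      constructor
      · rintro ⟨⟨V, ⟨⟨W, hW, rfl⟩, _⟩, rfl⟩, hU⟩
        exact ⟨⟨W, hW, preim_bind _ _ _⟩, hU⟩
      · rintro ⟨⟨W, hW, rfl⟩, hU⟩
        refine ⟨⟨preim g.toFun W, ⟨⟨W, hW, rfl⟩, ?_⟩, (preim_bind _ _ _).symm⟩, hU⟩
        intro h0
        apply hU
        rw [preim_bind, h0, preim_empty]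
    rw [← e]
    exact h⟩
  id_comp f := PMap.ext (funext fun x => rfl)
  comp_id f := PMap.ext (funext fun x => Option.bind_fun_some _)
  assoc f g h := PMap.ext (funext fun x => Option.bind_assoc _ _ _)

theorem semidecidable_empty (w : SSP) : w.Semidecidable ∅ :=
  ⟨∅, w.empty_mem, by simp⟩

theorem semidecidable_preim {v w : SSP} (f : v ⟶ w) {U : Set w.carrier}
    (h : w.Semidecidable U) : v.Semidecidable (preim f.toFun U) := by
  obtain ⟨P, hP, rfl⟩ := h
  refine ⟨_, f.preim_mem P hP, ?_⟩
  ext x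
  simp only [preim, Set.mem_ofPred_eq, Set.mem_sUnion, Set.mem_sdiff, Set.mem_image,
    Set.mem_singleton_iff]
  constructor
  · rintro ⟨y, ⟨U, hU, hy⟩, hxy⟩
    refine ⟨_, ⟨⟨U, hU, rfl⟩, ?_⟩, ⟨y, hy, hxy⟩⟩
    exact Set.Nonempty.ne_empty ⟨x, y, hy, hxy⟩
  · rintro ⟨_, ⟨⟨U, hU, rfl⟩, _⟩, y, hy, hxy⟩
    exact ⟨y, ⟨U, hU, hy⟩, hxy⟩

theorem nonempty_of_mem (w : SSP) {P : Set (Set w.carrier)} (hP : P ∈ w.parts)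
    {U : Set w.carrier} (hU : U ∈ P) : U.Nonempty :=
  Set.nonempty_iff_ne_empty.2 fun h => w.empty_notMem P hP (h ▸ hU)

/-- Simultaneous refinement of all the blocks of a partial partition. -/
theorem refine_all (w : SSP) {P : Set (Set w.carrier)} (hP : P ∈ w.parts)
    (Q : Set w.carrier → Set (Set w.carrier)) (hQ : ∀ U, Q U ∈ w.parts) :
    {T | ∃ U ∈ P, ∃ V ∈ Q U, T = U ∩ V ∧ T.Nonempty} ∈ w.parts := by
  have := w.finite
  have key : ∀ s : Set (Set w.carrier), s.Finite → s ⊆ P →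
      (P \ s) ∪ {T | ∃ U ∈ s, ∃ V ∈ Q U, T = U ∩ V ∧ T.Nonempty} ∈ w.parts := by
    intro s hs
    induction s, hs using Set.Finite.induction_on with
    | empty => intro _; simpa using hP
    | @insert U s hU hs ih =>
      intro hsub
      have hUP : U ∈ P := hsub (Set.mem_insert _ _)
      have ih' := ih ((Set.subset_insert _ _).trans hsub)
      have h := w.refine_mem _ ih' (Q U) (hQ U) U (Or.inl ⟨hUP, hU⟩)
      convert h using 1
      ext T
      constructor
      · rintro (⟨h1, h2⟩ | ⟨U', hU', V, hV, rfl, hne⟩)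
        · rw [Set.mem_insert_iff, not_or] at h2
          exact Or.inl ⟨Or.inl ⟨h1, h2.2⟩, h2.1⟩
        · rcases Set.mem_insert_iff.1 hU' with rfl | hU's
          · exact Or.inr ⟨⟨V, hV, rfl⟩, hne.ne_empty⟩
          · refine Or.inl ⟨Or.inr ⟨U', hU's, V, hV, rfl, hne⟩, ?_⟩
            intro e
            have e' : U' ∩ V = U := e
            obtain ⟨x, hx⟩ := hne
            have hd := w.disjoint P hP (hsub hU') hUP (by rintro rfl; exact hU hU's)
            exact Set.disjoint_left.1 hd hx.1 (e' ▸ hx)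
      · rintro (⟨⟨h1, h2⟩ | ⟨U', hU', V, hV, rfl, hne⟩, h3⟩ | ⟨⟨V, hV, rfl⟩, h2⟩)
        · exact Or.inl ⟨h1, by rw [Set.mem_insert_iff, not_or]; exact ⟨h3, h2⟩⟩
        · exact Or.inr ⟨U', Or.inr hU', V, hV, rfl, hne⟩
        · exact Or.inr ⟨U, Or.inl rfl, V, hV, rfl, Set.nonempty_iff_ne_empty.2 h2⟩
  simpa using key P (Set.toFinite P) subset_rfl

/-- Every block of a partial partition is semidecidable. -/
theorem semidecidable_of_mem (w : SSP) {P : Set (Set w.carrier)} (hP : P ∈ w.parts)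
    {U : Set w.carrier} (hU : U ∈ P) : w.Semidecidable U := by
  classical
  refine ⟨_, w.refine_all hP (fun V => if V = U then {Set.univ} \ {∅} else ∅) ?_, ?_⟩
  · intro V
    split_ifs
    · exact w.univ_mem
    · exact w.empty_mem
  · ext x
    constructor
    · intro hx
      refine ⟨U, ⟨U, hU, Set.univ, ?_, by simp, ⟨x, hx⟩⟩, hx⟩
      rw [if_pos rfl]
      exact ⟨rfl, Set.Nonempty.ne_empty ⟨x, trivial⟩⟩
    · rintro ⟨_, ⟨V, hV, W, hW, rfl, _⟩, hx⟩
      split_ifs at hW with h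
      · exact h ▸ hx.1
      · exact hW.elim

end SSP

/-! ### The site -/

/-- A category `C` with countably many morphisms and a faithful functor `F : C ⥤ SSP_⊥`. -/
structure Prediction : Type 1 where
  C : Type
  [cat : Category.{0} C]
  [countable : Countable (Σ a b : C, a ⟶ b)]
  F : C ⥤ SSP
  [faithful : F.Faithful]

attribute [instance] Prediction.cat

/-- The objects of the sum of the site `V` and of all the sites `I_{C,F}`: the common terminal
object `⋆`, the object `V`, and the objects `(c, U)` of the sites `I_{C,F}`. -/
inductive SiteObj : Type 1
  | star : SiteObj
  | vert : SiteObj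
  | part (i : Prediction) (c : i.C) (U : Set (i.F.obj c).carrier)
      (hU : (i.F.obj c).Semidecidable U) : SiteObj

namespace SiteObj

/-- The underlying set `|X|` of an object: `|⋆| = {*}`, `|V| = {0 ≤ 1 ≤ ⋯ ≤ ∞}`,
`|(c, U)| = U`. -/
def Pts : SiteObj → Type
  | star => Unit
  | vert => ℕ∞
  | part _ _ U _ => U

/-- The functions `|X| → |Y|` that are morphisms of the site: the constant functions (among them
all the functions from or to `|⋆|`); the Scott-continuous functions `V → V`; and, within one site
`I_{C,F}`, the functions `U → V` that are restrictions of a partial function `F φ` which is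
defined on all of `U`, for some `φ : c ⟶ d` in `C`. -/
inductive IsHom : ∀ {X Y : SiteObj}, (X.Pts → Y.Pts) → Prop
  | const {X Y : SiteObj} (f : X.Pts → Y.Pts) (hf : ∀ x y, f x = f y) : IsHom f
  | vert (f : ℕ∞ → ℕ∞) (hf : ScottContinuous f) : IsHom (X := .vert) (Y := .vert) f
  | part (i : Prediction) {c d : i.C} (φ : c ⟶ d)
      {U : Set (i.F.obj c).carrier} (hU : (i.F.obj c).Semidecidable U)
      {V : Set (i.F.obj d).carrier} (hV : (i.F.obj d).Semidecidable V)
      (f : U → V) (hf : ∀ x : U, (i.F.map φ).toFun x = some (f x : (i.F.obj d).carrier)) :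
      IsHom (X := .part i c U hU) (Y := .part i d V hV) f

theorem IsHom.id (X : SiteObj) : IsHom (fun x : X.Pts => x) := by
  cases X with
  | star => exact .const _ fun _ _ => rfl
  | vert => exact .vert _ ScottContinuous.id
  | part i c U hU =>
    refine .part i (𝟙 c) hU hU _ fun x => ?_
    rw [i.F.map_id]
    rfl

theorem IsHom.comp {X Y Z : SiteObj} {f : X.Pts → Y.Pts} {g : Y.Pts → Z.Pts}
    (hf : IsHom f) (hg : IsHom g) : IsHom (fun x => g (f x)) := by
  cases hg with
  | const _ hg => exact .const _ fun _ _ => hg _ _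
  | vert g hg =>
    cases hf with
    | const _ hf => exact .const _ fun x y => congrArg g (hf x y)
    | vert _ hf => exact .vert _ (ScottContinuous.comp hf hg)
  | part i ψ hV hW g hg =>
    cases hf with
    | const _ hf => exact .const _ fun x y => congrArg g (hf x y)
    | part _ φ hU _ _ hf =>
      refine .part i (φ ≫ ψ) hU hW _ fun x => ?_
      rw [i.F.map_comp]
      change ((i.F.map φ).toFun x).bind (i.F.map ψ).toFun = _
      rw [hf x]
      exact hg _

instance : Category.{0} SiteObj where
  Hom X Y := {f : X.Pts → Y.Pts // IsHom f}
  id X := ⟨fun x => x, .id X⟩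
  comp f g := ⟨fun x => g.1 (f.1 x), f.2.comp g.2⟩

/-- The inclusion `(c, V) ⟶ (c, U)` for `V ⊆ U`. -/
def incl {i : Prediction} {c : i.C} {U V : Set (i.F.obj c).carrier}
    (hV : (i.F.obj c).Semidecidable V) (hU : (i.F.obj c).Semidecidable U) (h : V ⊆ U) :
    part i c V hV ⟶ part i c U hU :=
  ⟨Set.inclusion h, .part i (𝟙 c) hV hU _ fun x => by rw [i.F.map_id]; rfl⟩

/-- The covering families: `⋆` and `V` are covered by their identities only, and `(c, U)` by the
inclusions `(c, V) ⟶ (c, U)`, `V ∈ P`, for each partial partition `P` with union `U`. -/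
inductive IsCover : ∀ X : SiteObj, Presieve X → Prop
  | star : IsCover star (Presieve.singleton (𝟙 star))
  | vert : IsCover vert (Presieve.singleton (𝟙 vert))
  | part (i : Prediction) (c : i.C) (P : Set (Set (i.F.obj c).carrier))
      (hP : P ∈ (i.F.obj c).parts) (U : Set (i.F.obj c).carrier)
      (hU : (i.F.obj c).Semidecidable U) (hPU : ⋃₀ P = U) :
      IsCover (part i c U hU)
        (Presieve.ofArrows
          (fun V : P => part i c V.1 ((i.F.obj c).semidecidable_of_mem hP V.2))
          (fun V => incl _ hU (hPU ▸ Set.subset_sUnion_of_mem V.2)))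

theorem exists_isCover (X : SiteObj) : ∃ T : Presieve X, IsCover X T ∧
    ∀ ⦃Z : SiteObj⦄ (g : Z ⟶ X), T g → Nonempty Z.Pts := by
  cases X with
  | star => exact ⟨_, .star, fun Z g hg => by cases hg; exact ⟨()⟩⟩
  | vert => exact ⟨_, .vert, fun Z g hg => by cases hg; exact ⟨(0 : ℕ∞)⟩⟩
  | part i c U hU =>
    obtain ⟨P, hP, hPU⟩ := id hU
    refine ⟨_, .part i c P hP U hU hPU.symm, fun Z g hg => ?_⟩
    obtain ⟨V⟩ := hg
    obtain ⟨x, hx⟩ := (i.F.obj c).nonempty_of_mem hP V.2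
    have y : V.1 := ⟨x, hx⟩
    exact ⟨y⟩

theorem isCover_pullback {X Y : SiteObj} (f : Y ⟶ X) (S : Presieve X) (hS : IsCover X S) :
    ∃ T : Presieve Y, IsCover Y T ∧ T.FactorsThruAlong S f := by
  cases hS with
  | star =>
    obtain ⟨T, hT, -⟩ := exists_isCover Y
    exact ⟨T, hT, fun Z g _ => ⟨_, g ≫ f, 𝟙 _, Presieve.singleton.mk, Category.comp_id _⟩⟩
  | vert =>
    obtain ⟨T, hT, -⟩ := exists_isCover Y
    exact ⟨T, hT, fun Z g _ => ⟨_, g ≫ f, 𝟙 _, Presieve.singleton.mk, Category.comp_id _⟩⟩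
  | part i c P hP U hU hPU =>
    obtain ⟨f, hf⟩ := f
    cases hf with
    | const f hf =>
      obtain ⟨T, hT, hne⟩ := exists_isCover Y
      refine ⟨T, hT, fun Z g hg => ?_⟩
      obtain ⟨z⟩ := hne g hg
      obtain ⟨V, hV, hz⟩ : (f (g.1 z)).1 ∈ ⋃₀ P := hPU ▸ (f (g.1 z)).2
      refine ⟨part i c V ((i.F.obj c).semidecidable_of_mem hP hV),
        ⟨fun _ => ⟨(f (g.1 z)).1, hz⟩, .const _ fun _ _ => rfl⟩, _,
        Presieve.ofArrows.mk (⟨V, hV⟩ : P), ?_⟩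
      exact Subtype.ext (funext fun x => hf (g.1 z) (g.1 x))
    | @part _ d _ φ W hW _ _ f hf =>
      obtain ⟨R, hR, hRW⟩ := id hW
      have hQ := (i.F.map φ).preim_mem P hP
      have hN := (i.F.obj d).refine_all hR (fun _ => _) (fun _ => hQ)
      have hNW : ⋃₀ {T | ∃ A ∈ R, ∃ B ∈ (SSP.preim (i.F.map φ).toFun '' P) \ {∅},
          T = A ∩ B ∧ T.Nonempty} = W := by
        ext x
        constructor
        · rintro ⟨_, ⟨A, hA, B, hB, rfl, _⟩, hx⟩
          exact hRW ▸ ⟨A, hA, hx.1⟩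
        · intro hx
          obtain ⟨A, hA, hxA⟩ : x ∈ ⋃₀ R := hRW ▸ hx
          obtain ⟨V, hV, hz⟩ : (f ⟨x, hx⟩).1 ∈ ⋃₀ P := hPU ▸ (f ⟨x, hx⟩).2
          have hxV : x ∈ SSP.preim (i.F.map φ).toFun V := ⟨_, hz, hf ⟨x, hx⟩⟩
          exact ⟨_, ⟨A, hA, _, ⟨⟨V, hV, rfl⟩, Set.Nonempty.ne_empty ⟨x, hxV⟩⟩, rfl,
            ⟨x, hxA, hxV⟩⟩, hxA, hxV⟩
      refine ⟨_, .part i d _ hN W hW hNW, fun Z g hg => ?_⟩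
      obtain ⟨⟨T, hT⟩⟩ := hg
      obtain ⟨A, hA, B, ⟨⟨V, hV, rfl⟩, _⟩, rfl, _⟩ := id hT
      have hTW : A ∩ SSP.preim (i.F.map φ).toFun V ⊆ W := fun x hx => hRW ▸ ⟨A, hA, hx.1⟩
      have hfV : ∀ (x : i.F.obj d |>.carrier) (hx : x ∈ A ∩ SSP.preim (i.F.map φ).toFun V),
          (f ⟨x, hTW hx⟩).1 ∈ V := by
        intro x hx
        obtain ⟨y, hy, hxy⟩ := hx.2
        have e := (hf ⟨x, hTW hx⟩).symm.trans hxy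
        exact (Option.some.inj e) ▸ hy
      refine ⟨part i c V ((i.F.obj c).semidecidable_of_mem hP hV),
        ⟨fun x => ⟨(f ⟨x.1, hTW x.2⟩).1, hfV x.1 x.2⟩,
          .part i φ _ _ _ fun x => hf ⟨x.1, hTW x.2⟩⟩, _,
        Presieve.ofArrows.mk (⟨V, hV⟩ : P), rfl⟩

/-- The coverage of the summed site. -/
def cov : Coverage SiteObj where
  coverings X := {S | IsCover X S}
  pullback _ _ f S hS := isCover_pullback f S hS

/-- The subsets `U' ⊆ |X|` that are elements of `Δ(X)`: all subsets of `|⋆|`; the empty set and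
the sets `{n, n + 1, …, ∞}` with `n` finite for `X = V`; the `U' ⊆ U` such that `(c, U')` is an
object, for `X = (c, U)`. -/
def IsOpen : ∀ X : SiteObj, Set X.Pts → Prop
  | star, _ => True
  | vert, U' => U' = ∅ ∨ ∃ n : ℕ, U' = Set.Ici (n : ℕ∞)
  | part i c U _, U' => (i.F.obj c).Semidecidable (Subtype.val '' (U' : Set U))

theorem isOpen_empty (X : SiteObj) : X.IsOpen ∅ := by
  cases X with
  | star => trivial
  | vert => exact Or.inl rfl
  | part i c U hU =>
    have e : (Subtype.val '' (∅ : Set U)) = ∅ := Set.image_empty _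
    change (i.F.obj c).Semidecidable (Subtype.val '' (∅ : Set U))
    rw [e]
    exact (i.F.obj c).semidecidable_empty

theorem isOpen_univ (X : SiteObj) : X.IsOpen Set.univ := by
  cases X with
  | star => trivial
  | vert => exact Or.inr ⟨0, Set.ext fun (x : ℕ∞) => ⟨fun _ => bot_le (a := x), fun _ => trivial⟩⟩
  | part i c U hU =>
    have e : (Subtype.val '' (Set.univ : Set U)) = U := by simp
    change (i.F.obj c).Semidecidable (Subtype.val '' (Set.univ : Set U))
    rw [e]
    exact hU

theorem IsOpen.preimage {X Y : SiteObj} (f : Y ⟶ X) {U' : Set X.Pts} (h : X.IsOpen U') :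
    Y.IsOpen (f.1 ⁻¹' U') := by
  obtain ⟨f, hf⟩ := f
  cases hf with
  | const f hf =>
    have : f ⁻¹' U' = ∅ ∨ f ⁻¹' U' = Set.univ := by
      rcases Set.eq_empty_or_nonempty (f ⁻¹' U') with h0 | ⟨x, hx⟩
      · exact Or.inl h0
      · exact Or.inr (Set.eq_univ_of_forall fun y => by
          change f y ∈ U'; rw [hf y x]; exact hx)
    rcases this with e | e
    · exact e.symm ▸ isOpen_empty Y
    · exact e.symm ▸ isOpen_univ Y
  | vert f hf =>
    rcases h with rfl | ⟨n, rfl⟩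
    · exact Or.inl rfl
    · by_cases hn : ∃ m : ℕ, (n : ℕ∞) ≤ f m
      · classical
        refine Or.inr ⟨Nat.find hn, ?_⟩
        ext x
        change (n : ℕ∞) ≤ f x ↔ ((Nat.find hn : ℕ) : ℕ∞) ≤ x
        constructor
        · intro hx
          change ℕ∞ at x
          induction x using ENat.recTopCoe with
          | top => exact le_top
          | coe k => exact Nat.cast_le.2 (Nat.find_min' hn hx)
        · intro hx
          exact (Nat.find_spec hn).trans (hf.monotone hx)
      · push Not at hn
        refine Or.inl (Set.eq_empty_of_forall_notMem fun x hx => ?_)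
        have hx' : (n : ℕ∞) ≤ f ⊤ := le_trans hx (hf.monotone le_top)
        have hl : IsLUB (Set.range fun m : ℕ => (m : ℕ∞)) ⊤ := by
          refine ⟨fun _ _ => le_top, fun b hb => ?_⟩
          induction b using ENat.recTopCoe with
          | top => exact le_rfl
          | coe k =>
            have := hb ⟨k + 1, rfl⟩
            exact absurd (Nat.cast_le.1 this) (by omega)
        have hl' := hf (Set.range_nonempty _)
          (directedOn_range.2 (Monotone.directed_le fun _ _ h => Nat.cast_le.2 h)) hl
        have hn0 : n ≠ 0 := by
          rintro rfl
          exact absurd (hn 0) (by simp)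
        have hub : f ⊤ ≤ ((n - 1 : ℕ) : ℕ∞) := by
          refine hl'.2 ?_
          rintro _ ⟨_, ⟨m, rfl⟩, rfl⟩
          obtain ⟨j, hj⟩ := ENat.ne_top_iff_exists.1 (ne_top_of_lt (hn m))
          have hm := hn m
          change f (m : ℕ∞) ≤ _
          rw [← hj] at hm ⊢
          have := Nat.cast_lt.1 hm
          exact Nat.cast_le.2 (by omega)
        have := Nat.cast_le.1 (hx'.trans hub)
        omega
  | @part i d c φ W hW V hV f hf =>
    have e := SSP.semidecidable_preim (i.F.map φ) h
    obtain ⟨P, hP, hPe⟩ := e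
    obtain ⟨R, hR, hRW⟩ := hW
    refine ⟨_, (i.F.obj d).refine_all hR (fun _ => P) (fun _ => hP), ?_⟩
    ext x
    constructor
    · rintro ⟨⟨x, hx⟩, hxU, rfl⟩
      obtain ⟨A, hA, hxA⟩ : x ∈ ⋃₀ R := hRW ▸ hx
      have hx1 : x ∈ SSP.preim (i.F.map φ).toFun (Subtype.val '' (U' : Set V)) :=
        ⟨_, ⟨f ⟨x, hx⟩, hxU, rfl⟩, hf ⟨x, hx⟩⟩
      obtain ⟨B, hB, hxB⟩ : x ∈ ⋃₀ P := hPe ▸ hx1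
      exact ⟨A ∩ B, ⟨A, hA, B, hB, rfl, ⟨x, hxA, hxB⟩⟩, hxA, hxB⟩
    · rintro ⟨_, ⟨A, hA, B, hB, rfl, _⟩, hxA, hxB⟩
      have hxW : x ∈ W := hRW ▸ ⟨A, hA, hxA⟩
      have hx1 : x ∈ SSP.preim (i.F.map φ).toFun (Subtype.val '' (U' : Set V)) :=
        hPe ▸ ⟨B, hB, hxB⟩
      obtain ⟨_, ⟨y, hy, rfl⟩, hxy⟩ := hx1
      refine ⟨⟨x, hxW⟩, ?_, rfl⟩
      have e1 := (hf ⟨x, hxW⟩).symm.trans hxy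
      have e2 : f ⟨x, hxW⟩ = y := Subtype.ext (Option.some.inj e1)
      change f ⟨x, hxW⟩ ∈ (U' : Set V)
      rw [e2]
      exact hy

/-- Semidecidable subsets can be glued along covers. -/
theorem isOpen_of_cover {X : SiteObj} {S : Presieve X} (hS : IsCover X S) {U' : Set X.Pts}
    (h : ∀ ⦃Y : SiteObj⦄ (f : Y ⟶ X), S f → Y.IsOpen (f.1 ⁻¹' U')) : X.IsOpen U' := by
  cases hS with
  | star => exact h (𝟙 _) Presieve.singleton.mk
  | vert => exact h (𝟙 _) Presieve.singleton.mk
  | part i c P hP U hU hPU =>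
    have hV : ∀ V : P, (i.F.obj c).Semidecidable (V.1 ∩ Subtype.val '' (U' : Set U)) := by
      intro V
      have := h _ (Presieve.ofArrows.mk V)
      change (i.F.obj c).Semidecidable (Subtype.val '' _) at this
      convert this using 1
      ext x
      constructor
      · rintro ⟨hx, y, hy, rfl⟩
        exact ⟨⟨y.1, hx⟩, hy, rfl⟩
      · rintro ⟨y, hy, rfl⟩
        exact ⟨y.2, _, hy, rfl⟩
    choose Q hQ hQe using hV
    classical
    refine ⟨_, (i.F.obj c).refine_all hP (fun V => if hV : V ∈ P then Q ⟨V, hV⟩ else ∅) ?_, ?_⟩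
    · intro V
      split_ifs with hV
      · exact hQ _
      · exact (i.F.obj c).empty_mem
    · ext x
      constructor
      · rintro ⟨y, hy, rfl⟩
        obtain ⟨V, hV, hyV⟩ : y.1 ∈ ⋃₀ P := hPU ▸ y.2
        have hx : y.1 ∈ V ∩ Subtype.val '' (U' : Set U) := ⟨hyV, y, hy, rfl⟩
        obtain ⟨B, hB, hyB⟩ : y.1 ∈ ⋃₀ Q ⟨V, hV⟩ := (hQe ⟨V, hV⟩) ▸ hx
        exact ⟨V ∩ B, ⟨V, hV, B, by rw [dif_pos hV]; exact hB, rfl, ⟨_, hyV, hyB⟩⟩, hyV, hyB⟩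
      · rintro ⟨_, ⟨V, hV, B, hB, rfl, _⟩, hxV, hxB⟩
        rw [dif_pos hV] at hB
        have hx : x ∈ V ∩ Subtype.val '' (U' : Set U) :=
          (hQe ⟨V, hV⟩) ▸ ⟨B, hB, hxB⟩
        exact hx.2

/-- Covers are jointly surjective on points. -/
theorem exists_of_cover {X : SiteObj} {S : Presieve X} (hS : IsCover X S) (x : X.Pts) :
    ∃ (Y : SiteObj) (f : Y ⟶ X) (y : Y.Pts), S f ∧ f.1 y = x := by
  cases hS with
  | star => exact ⟨_, 𝟙 _, x, Presieve.singleton.mk, rfl⟩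
  | vert => exact ⟨_, 𝟙 _, x, Presieve.singleton.mk, rfl⟩
  | part i c P hP U hU hPU =>
    obtain ⟨V, hV, hx⟩ : x.1 ∈ ⋃₀ P := hPU ▸ x.2
    exact ⟨part i c V ((i.F.obj c).semidecidable_of_mem hP hV), _, ⟨x.1, hx⟩, Presieve.ofArrows.mk (⟨V, hV⟩ : P), rfl⟩

/-- The map `⋆ ⟶ X` with value `x`. -/
def point {X : SiteObj} (x : X.Pts) : star ⟶ X := ⟨fun _ => x, .const _ fun _ _ => rfl⟩

end SiteObj

open SiteObj

/-- The topos `𝒢` of sheaves on the summed site. -/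
abbrev GTopos : Type 2 := Sheaf SiteObj.cov.toGrothendieck (Type 1)

instance : HasColimitsOfShape ℕ GTopos := Sheaf.instHasColimitsOfShape
instance : HasInitial GTopos := Sheaf.instHasColimitsOfShape
instance : HasCoproductsOfShape ℕ GTopos := Sheaf.instHasColimitsOfShape

/-- The presheaf `Δ` of semidecidable subsets. -/
def deltaPresheaf : SiteObjᵒᵖ ⥤ Type 1 where
  obj X := ULift.{1} {U' : Set X.unop.Pts // X.unop.IsOpen U'}
  map f := ↾(fun U' => ⟨⟨f.unop.1 ⁻¹' U'.down.1, U'.down.2.preimage f.unop⟩⟩)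

theorem deltaPresheaf_isSheaf :
    Presheaf.IsSheaf SiteObj.cov.toGrothendieck deltaPresheaf := by
  rw [isSheaf_iff_isSheaf_of_type, Presieve.isSheaf_coverage]
  intro X S hS
  replace hS : IsCover X S := hS
  rw [← Presieve.isSeparatedFor_and_exists_isAmalgamation_iff_isSheafFor]
  constructor
  · rintro x ⟨⟨s, hs⟩⟩ ⟨⟨s', hs'⟩⟩ h h'
    have e : s = s' := by
      ext p
      obtain ⟨Y, f, y, hf, rfl⟩ := exists_of_cover hS p
      have e1 := congrArg (fun q => q.down.1) ((h f hf).trans (h' f hf).symm)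
      exact Set.ext_iff.1 e1 y
    subst e
    rfl
  · intro x hx
    have key : ∀ {Y Y' : SiteObj} (f : Y ⟶ X) (hf : S f) (f' : Y' ⟶ X) (hf' : S f')
        (y : Y.Pts) (y' : Y'.Pts), f.1 y = f'.1 y' →
        (y ∈ (x f hf).down.1 ↔ y' ∈ (x f' hf').down.1) := by
      intro Y Y' f hf f' hf' y y' e
      have := hx (point y) (point y') hf hf' (Subtype.ext (funext fun _ => e))
      have e1 := congrArg (fun q => q.down.1) this
      exact Set.ext_iff.1 e1 ()
    have hpre : ∀ ⦃Y : SiteObj⦄ (f : Y ⟶ X) (hf : S f),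
        f.1 ⁻¹' {p | ∃ (Y : SiteObj) (f : Y ⟶ X) (hf : S f) (y : Y.Pts),
          f.1 y = p ∧ y ∈ (x f hf).down.1} = (x f hf).down.1 := by
      intro Y f hf
      ext y
      constructor
      · rintro ⟨Y', f', hf', y', e, hy'⟩
        exact (key f' hf' f hf y' y e).1 hy'
      · intro hy
        exact ⟨Y, f, hf, y, rfl, hy⟩
    refine ⟨⟨⟨{p | ∃ (Y : SiteObj) (f : Y ⟶ X) (hf : S f) (y : Y.Pts),
          f.1 y = p ∧ y ∈ (x f hf).down.1}, isOpen_of_cover hS fun Y f hf => ?_⟩⟩,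
          fun Y f hf => ?_⟩
    · rw [hpre f hf]; exact (x f hf).down.2
    · exact ULift.ext _ _ (Subtype.ext (hpre f hf))

/-- The sheaf `Δ_𝒢`. -/
def deltaG : GTopos := ⟨deltaPresheaf, deltaPresheaf_isSheaf⟩

/-- The point `⊤ : 1 ⟶ Δ_𝒢`, given by the subsets `|X| ⊆ |X|`. -/
def trueG : 𝟙_ GTopos ⟶ deltaG :=
  ⟨{ app := fun X => ↾(fun _ => ⟨⟨Set.univ, isOpen_univ X.unop⟩⟩)
     naturality := fun _ _ _ => rfl }⟩

/-- The lifting functor `L_𝒢`. -/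
abbrev liftG : GTopos ⥤ GTopos := liftFunctor trueG

/-- The unit `η` of the lifting functor `L_𝒢`. -/
abbrev unitG : 𝟭 GTopos ⟶ liftG := liftUnit trueG

/-- The point `⊥ : 1 ⟶ L_𝒢 1`: the partial sections of `1` with domain `∅`. -/
def botG : 𝟙_ GTopos ⟶ liftG.obj (𝟙_ GTopos) :=
  ⟨{ app := fun X => ↾(fun _ =>
        { dom := ⟨⟨∅, isOpen_empty X.unop⟩⟩
          val := fun _ _ => PUnit.unit
          map_val := fun _ _ _ _ => rfl })
     naturality := fun _ _ _ => rfl }⟩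

/-- The natural numbers object `N_𝒢 = ∑₀^∞ 1`. -/
def natG : GTopos := ∐ fun _ : ℕ => 𝟙_ GTopos

/-- `(E, t : 1 ⟶ Δ)` is a normal model: `E` is a Grothendieck topos, `t` is a generic semidecidable
subobject, and, for the lifting functor `L` of `t` (which exists and is unique up to a unique
isomorphism) with its point `⊥`, the object `L (∑₀^∞ 1)` is `L`-complete. -/
structure IsNormalModel {E : Type u₁} [Category.{v₁} E] [CartesianMonoidalCategory E]
    [HasInitial E] [HasCoproductsOfShape ℕ E] [HasColimitsOfShape ℕ E] [HasLimitsOfShape ℕᵒᵖ E]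
    {Δ : E} (t : 𝟙_ E ⟶ Δ) : Prop where
  topos : IsGrothendieckTopos.{v, u} E
  generic : IsGenericSemidecidable t
  complete : ∃ (L : E ⥤ E) (η : 𝟭 E ⟶ L) (b : 𝟙_ E ⟶ L.obj (𝟙_ E)),
    IsLifting t L η ∧ IsBottom η b ∧ IsComplete L b (L.obj (∐ fun _ : ℕ => 𝟙_ E))

end

end PCFv

/-!
A sheaf on the summed site is studied through its sections and their restrictions to points
`⋆ ⟶ X`. A square of sheaves is a pullback as soon as it is one on sections (`isPullback_iff`), and a
truth value in `Δ(X)` is a set of points. So classifying maps are unique, and a semidecidable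
subobject of `A` is given by the points of `A` that it contains. Semidecidable maps compose because
a nonempty open subset of `|X|` is the image of a single map of the site whose direct images of open
sets are open (`exists_range_eq`): the inclusion `(c, U') ⟶ (c, U)`, or the shift `x ↦ x + m` of `V`.
The universal property of `L` is checked directly on partial sections.

For completeness, let `N = ∑ 1`. Sections of `N` are locally numerals, so sections of `L N` are
determined by their points (`lift_nat_ext`). Since `V` has no proper covers, a section of `L N` over
`V` is undefined or a constant on some `{n, …, ∞}` (`lift_nat_vert`). Two consequences carry the proof.

* Uniqueness of extensions along `A × ω ⟶ A × ω̄`: every point of `ω̄` is the value at `∞` of a section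
  of `ω̄` over `V` whose values at the finite points lie in `ω` (`exists_section_vert`), and a section of
  `L N` over `V` is determined at `∞` by its values at the finite points (`lift_nat_vert_eq_top`).
* Existence: given `f : A × ω ⟶ L N`, restrict `f` along the truncations `ω̄ ⟶ Lⁿ 1 ⟶ ω`. At each
  section of `A × ω̄` over `X` this gives a sequence in `(L N)(X)`. Truncations of a point of `ω̄` at `n`
  and at `n + 1` are joined by a section over `V` (`pathLE_extend_collapse`), so the sequence is
  increasing. Increasing sequences in `(L N)(X)` are eventually constant (`IsChain.eventually_eq`):
  the objects other than `V` have finitely many points, and over `V` the domain of definition can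
  only grow finitely often. The eventual value is natural in `X` and is the required extension.
-/

namespace PCFv

open SiteObj

/-! ### Sections of sheaves on the summed site -/

/-- The sections `A(X)` of a sheaf over an object of the site. -/
abbrev Sec (A : GTopos) (X : SiteObj) : Type 1 := A.obj.obj (op X)

/-- Restriction of sections along a map of the site. -/
def res {A : GTopos} {X Y : SiteObj} (f : Y ⟶ X) (a : Sec A X) : Sec A Y := A.obj.map f.op a

/-- The action of a map of sheaves on sections. -/
def ap {A B : GTopos} (φ : A ⟶ B) {X : SiteObj} (a : Sec A X) : Sec B X := φ.hom.app (op X) a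

section Sections

variable {A B D : GTopos} {X Y Z : SiteObj}

theorem res_res (f : Y ⟶ X) (g : Z ⟶ Y) (a : Sec A X) : res g (res f a) = res (g ≫ f) a :=
  (PartialSection.map_comp_apply A.obj f g a).symm

theorem res_id (a : Sec A X) : res (𝟙 X) a = a := A.obj.map_id_apply (op X) a

theorem res_ap (φ : A ⟶ B) (f : Y ⟶ X) (a : Sec A X) : res f (ap φ a) = ap φ (res f a) :=
  (NatTrans.naturality_apply φ.hom f.op a).symm

theorem ap_comp (φ : A ⟶ B) (ψ : B ⟶ D) (a : Sec A X) : ap (φ ≫ ψ) a = ap ψ (ap φ a) := rfl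

theorem ap_id (a : Sec A X) : ap (𝟙 A) a = a := rfl

theorem hom_ext_ap {φ ψ : A ⟶ B} (h : ∀ (X : SiteObj) (a : Sec A X), ap φ a = ap ψ a) :
    φ = ψ := by
  ext X a
  exact h X.unop a

/-- A natural family of functions on sections is a map of sheaves. -/
def homOfSec (F : ∀ X : SiteObj, Sec A X → Sec B X)
    (hF : ∀ {X Y : SiteObj} (f : Y ⟶ X) (a : Sec A X), res f (F X a) = F Y (res f a)) : A ⟶ B :=
  ⟨{ app := fun X => ↾(F X.unop)
     naturality := fun X Y f => by
      ext a
      exact (hF f.unop a).symm }⟩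

/-- The section `(a, b)` of a product. -/
def pair (a : Sec A X) (b : Sec B X) : Sec (A ⊗ B) X := (a, b)

theorem exists_pair (p : Sec (A ⊗ B) X) : ∃ a b, p = pair a b := ⟨p.1, p.2, rfl⟩

theorem res_pair (f : Y ⟶ X) (a : Sec A X) (b : Sec B X) :
    res f (pair a b) = pair (res f a) (res f b) := rfl

theorem ap_whiskerLeft_pair (φ : B ⟶ D) (a : Sec A X) (b : Sec B X) :
    ap (A ◁ φ) (pair a b) = pair a (ap φ b) := rfl

theorem sec_unit_eq (a b : Sec (𝟙_ GTopos) X) : a = b := by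
  change PUnit at a b
  exact Subsingleton.elim (α := PUnit) a b

/-- Sections of a sheaf agreeing on a covering sieve are equal. -/
theorem sec_ext_of_mem {S : Sieve X} (hS : S ∈ SiteObj.cov.toGrothendieck X) {a b : Sec A X}
    (h : ∀ {Y : SiteObj} (f : Y ⟶ X), S f → res f a = res f b) : a = b := by
  have hA := (isSheaf_iff_isSheaf_of_type _ A.obj).1 A.property
  exact ((hA S hS).isSeparatedFor).ext fun Y f hf => h f hf

/-- Pullbacks of sheaves are computed on sections. -/
theorem isPullback_iff {P : GTopos} {fst : P ⟶ A} {snd : P ⟶ B} {f : A ⟶ D} {g : B ⟶ D} :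
    IsPullback fst snd f g ↔ (∀ X (p : Sec P X), ap f (ap fst p) = ap g (ap snd p)) ∧
      ∀ X (a : Sec A X) (b : Sec B X), ap f a = ap g b →
        ∃! p : Sec P X, ap fst p = a ∧ ap snd p = b := by
  constructor
  · intro h
    refine ⟨fun X p => congrArg (fun k => ap k p) h.w, fun X a b hab => ?_⟩
    have h' := (h.map (sheafToPresheaf _ _)).map ((evaluation _ (Type 1)).obj (op X))
    obtain ⟨p, h1, h2⟩ := (Types.exists_of_isPullback h' a b hab)
    refine ⟨p, ⟨h1, h2⟩, fun q hq => Types.ext_of_isPullback h' ?_ ?_⟩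
    · exact hq.1.trans h1.symm
    · exact hq.2.trans h2.symm
  · rintro ⟨hw, h⟩
    have w : fst ≫ f = snd ≫ g := hom_ext_ap hw
    refine ⟨⟨w⟩, ⟨PullbackCone.IsLimit.mk w (fun s => homOfSec
      (fun X q => (h X (ap s.fst q) (ap s.snd q)
        (congrArg (fun k => ap k q) s.condition)).choose) ?_) ?_ ?_ ?_⟩⟩
    · intro X Y k q
      refine (h Y (ap s.fst (res k q)) (ap s.snd (res k q))
        (congrArg (fun l => ap l (res k q)) s.condition)).unique ?_
        (h Y _ _ (congrArg (fun l => ap l (res k q)) s.condition)).choose_spec.1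
      have := (h X (ap s.fst q) (ap s.snd q)
        (congrArg (fun k => ap k q) s.condition)).choose_spec.1
      refine ⟨?_, ?_⟩
      · rw [← res_ap, this.1, res_ap]
      · rw [← res_ap, this.2, res_ap]
    · intro s
      exact hom_ext_ap fun X q => (h X (ap s.fst q) (ap s.snd q)
        (congrArg (fun k => ap k q) s.condition)).choose_spec.1.1
    · intro s
      exact hom_ext_ap fun X q => (h X (ap s.fst q) (ap s.snd q)
        (congrArg (fun k => ap k q) s.condition)).choose_spec.1.2
    · intro s m h1 h2
      refine hom_ext_ap fun X q => ?_
      refine (h X (ap s.fst q) (ap s.snd q) (congrArg (fun k => ap k q) s.condition)).unique ?_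
        (h X (ap s.fst q) (ap s.snd q) (congrArg (fun k => ap k q) s.condition)).choose_spec.1
      exact ⟨congrArg (fun k => ap k q) h1, congrArg (fun k => ap k q) h2⟩

/-- Every section of a colimit of sheaves comes locally from the diagram: the sections which do
form a subsheaf through which the whole cocone factors. -/
theorem exists_cover_of_isColimit {K : Type*} [Category K] {F : K ⥤ GTopos} {c : Cocone F}
    (hc : IsColimit c) (x : Sec c.pt X) :
    ∃ S ∈ SiteObj.cov.toGrothendieck X, ∀ {Y : SiteObj} (f : Y ⟶ X), S f →
      ∃ (k : K) (d : Sec (F.obj k) Y), ap (c.ι.app k) d = res f x := by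
  have hA := (isSheaf_iff_isSheaf_of_type _ c.pt.obj).1 c.pt.property
  let G : Subfunctor c.pt.obj :=
    { obj := fun U => {x | ∃ (k : K) (d : Sec (F.obj k) U.unop), ap (c.ι.app k) d = x}
      map := by
        rintro U V i _ ⟨k, d, rfl⟩
        exact ⟨k, res i.unop d, (res_ap _ i.unop d).symm⟩ }
  let G' := G.sheafify SiteObj.cov.toGrothendieck
  let I : GTopos := ⟨G'.toFunctor, (isSheaf_iff_isSheaf_of_type _ _).2 (G.sheafify_isSheaf hA)⟩
  let inc : I ⟶ c.pt := ⟨G'.ι⟩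
  have inc_inj : ∀ {Y} (a b : Sec I Y), ap inc a = ap inc b → a = b := fun a b e => Subtype.ext e
  let toI : ∀ k, F.obj k ⟶ I := fun k => homOfSec
    (fun Y d => ⟨ap (c.ι.app k) d, G.le_sheafify _ _ ⟨k, d, rfl⟩⟩)
    (fun f a => Subtype.ext (res_ap _ f a))
  have htoI : ∀ k, toI k ≫ inc = c.ι.app k := fun k => rfl
  let c' : Cocone F :=
    { pt := I
      ι := { app := toI
             naturality := fun k l e => hom_ext_ap fun Y a => inc_inj _ _ (by
              change ap (c.ι.app l) (ap (F.map e) a) = ap (c.ι.app k) a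
              rw [← ap_comp, c.w]) } }
  have h1 : hc.desc c' ≫ inc = 𝟙 c.pt := hc.hom_ext fun k => by
    rw [← Category.assoc, hc.fac, Category.comp_id]; rfl
  have h2 : ap inc (ap (hc.desc c') x) = x := congrArg (fun k => ap k x) h1
  have h3 : x ∈ G'.obj (op X) := h2 ▸ (ap (hc.desc c') x).2
  exact ⟨_, h3, fun f hf => hf⟩

end Sections

/-! ### Points of the site -/

/-- The covering sieves of `⋆` and `V` are the maximal ones. -/
theorem covering_eq_top {X : SiteObj} {S : Sieve X} (hS : S ∈ SiteObj.cov.toGrothendieck X)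
    (hX : X = star ∨ X = vert) : S = ⊤ := by
  replace hS : SiteObj.cov.Saturate X S := hS
  induction hS with
  | of X S hS =>
    replace hS : IsCover X S := hS
    rw [← Sieve.id_mem_iff_eq_top]
    cases hS with
    | star => exact Sieve.le_generate _ _ _ Presieve.singleton.mk
    | vert => exact Sieve.le_generate _ _ _ Presieve.singleton.mk
    | part => simp at hX
  | top => rfl
  | transitive X R S _ _ ih1 ih2 =>
    obtain rfl := ih1 hX
    have := ih2 (f := 𝟙 X) trivial hX
    rwa [Sieve.pullback_id] at this

/-- An object without points is covered by the empty family. -/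
theorem bot_covering_of_isEmpty {X : SiteObj} (hX : IsEmpty X.Pts) :
    ⊥ ∈ SiteObj.cov.toGrothendieck X := by
  obtain ⟨T, hT, hne⟩ := exists_isCover X
  refine SiteObj.cov.toGrothendieck.superset_covering ?_ (Coverage.Saturate.of X T hT)
  rintro Z _ ⟨W, g, h, hT, rfl⟩
  obtain ⟨w⟩ := hne h hT
  exact (hX.false (h.1 w)).elim

theorem sec_ext_of_isEmpty {A : GTopos} {X : SiteObj} (hX : IsEmpty X.Pts) (a b : Sec A X) :
    a = b :=
  sec_ext_of_mem (bot_covering_of_isEmpty hX) fun _ h => h.elim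

theorem exists_sec_of_isEmpty (A : GTopos) {X : SiteObj} (hX : IsEmpty X.Pts) :
    Nonempty (Sec A X) :=
  ⟨(Sheaf.isTerminalOfBotCover A X (bot_covering_of_isEmpty hX)).from PUnit.{2} PUnit.unit⟩

theorem res_point {A : GTopos} {X Y : SiteObj} (f : Y ⟶ X) (y : Y.Pts) (a : Sec A X) :
    res (point y) (res f a) = res (point (f.1 y)) a := res_res _ _ _

/-! ### Semidecidable subobjects -/

/-- The subset of `|X|` underlying a section of `Δ`. -/
def carrier {X : SiteObj} (p : Sec deltaG X) : Set X.Pts := p.down.1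

/-- The section of `Δ` given by an open subset. -/
def ofOpen {X : SiteObj} (U : Set X.Pts) (hU : X.IsOpen U) : Sec deltaG X := ⟨⟨U, hU⟩⟩

theorem delta_ext {X : SiteObj} {p q : Sec deltaG X} (h : carrier p = carrier q) : p = q :=
  ULift.ext _ _ (Subtype.ext h)

theorem carrier_res {X Y : SiteObj} (f : Y ⟶ X) (p : Sec deltaG X) :
    carrier (res f p) = f.1 ⁻¹' carrier p := rfl

theorem isOpen_carrier {X : SiteObj} (p : Sec deltaG X) : X.IsOpen (carrier p) := p.down.2

theorem holds_iff {X : SiteObj} {p : Sec deltaG X} :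
    Holds trueG p ↔ carrier p = Set.univ :=
  ⟨fun ⟨_, hu⟩ => hu ▸ rfl, fun h => ⟨PUnit.unit, delta_ext h.symm⟩⟩

theorem holds_res_iff {X Y : SiteObj} {p : Sec deltaG X} (f : Y ⟶ X) :
    Holds trueG (deltaG.obj.map f.op p) ↔ ∀ y, f.1 y ∈ carrier p :=
  holds_iff.trans Set.eq_univ_iff_forall

theorem mem_carrier_iff {X : SiteObj} {p : Sec deltaG X} (x : X.Pts) :
    x ∈ carrier p ↔ carrier (res (point x) p) = Set.univ :=
  ⟨fun h => Set.eq_univ_of_forall fun _ => h, fun h => Set.eq_univ_iff_forall.1 h ()⟩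

/-- A square with right-hand side `⊤` is a pullback iff `m` is injective on sections, with image
the sections on which `φ` is true. -/
theorem isPullback_true_iff {A' A : GTopos} {m : A' ⟶ A} {φ : A ⟶ deltaG} :
    IsPullback m (toUnit A') φ trueG ↔
      (∀ X (a b : Sec A' X), ap m a = ap m b → a = b) ∧
      ∀ X (a : Sec A X), (∃ a', ap m a' = a) ↔ carrier (ap φ a) = Set.univ := by
  rw [isPullback_iff]
  constructor
  · rintro ⟨hw, h⟩
    refine ⟨fun X a b e => ?_, fun X a => ⟨?_, fun e => ?_⟩⟩
    · exact (h X (ap m b) PUnit.unit (hw X b)).unique ⟨e, sec_unit_eq _ _⟩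
        ⟨rfl, sec_unit_eq _ _⟩
    · rintro ⟨a', rfl⟩
      rw [hw X a']; rfl
    · obtain ⟨a', ha', -⟩ := h X a PUnit.unit (delta_ext e)
      exact ⟨a', ha'.1⟩
  · rintro ⟨hm, h⟩
    refine ⟨fun X p => delta_ext ((h X _).1 ⟨p, rfl⟩), fun X a b e => ?_⟩
    obtain ⟨a', rfl⟩ := (h X a).2 (congrArg carrier e)
    exact ⟨a', ⟨rfl, sec_unit_eq _ _⟩, fun q hq => hm X _ _ hq.1⟩

theorem mem_carrier_classifier_iff {A' A : GTopos} {m : A' ⟶ A} {φ : A ⟶ deltaG}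
    (h : IsPullback m (toUnit A') φ trueG) {X : SiteObj} (a : Sec A X) (x : X.Pts) :
    x ∈ carrier (ap φ a) ↔ ∃ a' : Sec A' star, ap m a' = res (point x) a := by
  rw [mem_carrier_iff, res_ap, (isPullback_true_iff.1 h).2]

/-- A truth value is determined by the points at which it holds, so a classifying map is determined
by the subobject it classifies. -/
theorem classifier_unique {A' A : GTopos} {m : A' ⟶ A} {φ ψ : A ⟶ deltaG}
    (h : IsPullback m (toUnit A') φ trueG) (h' : IsPullback m (toUnit A') ψ trueG) : φ = ψ :=
  hom_ext_ap fun X a => delta_ext <| Set.ext fun x => by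
    rw [mem_carrier_classifier_iff h, mem_carrier_classifier_iff h']

theorem image_add_Ici (m n : ℕ) :
    (fun x : ℕ∞ => x + (m : ℕ∞)) '' Set.Ici (n : ℕ∞) = Set.Ici ((n + m : ℕ) : ℕ∞) := by
  ext x
  rw [Set.mem_Ici, Nat.cast_add]
  constructor
  · rintro ⟨y, hy, rfl⟩
    exact add_le_add_left (show (n : ℕ∞) ≤ y from hy) _
  · intro hx
    exact ⟨x - (m : ℕ∞), ENat.le_sub_of_add_le_right (ENat.natCast_ne_top m) hx,
      tsub_add_cancel_of_le (le_add_self.trans hx)⟩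

/-- The Scott-continuous map `x ↦ x + m` of `V`. -/
def shift (m : ℕ) : vert ⟶ vert :=
  ⟨fun x : ℕ∞ => x + (m : ℕ∞), .vert _ <| by
    intro d hd _ a ha
    refine ⟨?_, fun b hb => ?_⟩
    · rintro _ ⟨x, hx, rfl⟩
      exact add_le_add_left (ha.1 hx) _
    · have hmb : (m : ℕ∞) ≤ b := by
        obtain ⟨x, hx⟩ := hd
        exact le_add_self.trans (hb ⟨x, hx, rfl⟩)
      have : a ≤ b - (m : ℕ∞) := ha.2 fun x hx => by
        have := hb ⟨x, hx, rfl⟩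
        exact ENat.le_sub_of_add_le_right (ENat.natCast_ne_top m) this
      calc a + (m : ℕ∞) ≤ b - (m : ℕ∞) + (m : ℕ∞) := add_le_add_left this _
        _ = b := tsub_add_cancel_of_le hmb⟩

/-- A nonempty open subset is the image of a map of the site, which is moreover open. -/
theorem exists_range_eq {X : SiteObj} {U : Set X.Pts} (hU : X.IsOpen U) :
    U = ∅ ∨ ∃ (Y : SiteObj) (j : Y ⟶ X), Set.range j.1 = U ∧
      ∀ W, Y.IsOpen W → X.IsOpen (j.1 '' W) := by
  cases X with
  | star =>
    rcases U.eq_empty_or_nonempty with h | ⟨⟨⟩, h⟩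
    · exact .inl h
    · refine .inr ⟨star, 𝟙 _, ?_, fun _ _ => trivial⟩
      exact Set.Subset.antisymm (fun _ _ => h) (fun x _ => ⟨x, rfl⟩)
  | vert =>
    rcases hU with rfl | ⟨m, rfl⟩
    · exact .inl rfl
    · have key := image_add_Ici m
      refine .inr ⟨vert, shift m, ?_, ?_⟩
      · have h0 : (Set.univ : Set ℕ∞) = Set.Ici ((0 : ℕ) : ℕ∞) :=
          Set.ext fun x => ⟨fun _ => bot_le (a := x), fun _ => trivial⟩
        have := key 0
        rw [← h0, Set.image_univ, Nat.zero_add] at this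
        exact this
      · rintro W (rfl | ⟨n, rfl⟩)
        · exact .inl (Set.image_empty _)
        · exact .inr ⟨n + m, key n⟩
  | part i c V hV =>
    refine .inr ⟨part i c _ hU, incl hU hV ?_, ?_, ?_⟩
    · rintro _ ⟨x, _, rfl⟩
      exact x.2
    · ext x
      constructor
      · rintro ⟨⟨_, y, hy, rfl⟩, rfl⟩
        exact hy
      · intro hx
        exact ⟨⟨_, x, hx, rfl⟩, rfl⟩
    · intro W hW
      change (i.F.obj c).Semidecidable _
      change (i.F.obj c).Semidecidable _ at hW
      convert hW using 1
      ext x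
      constructor
      · rintro ⟨_, ⟨y, hy, rfl⟩, rfl⟩
        exact ⟨y, hy, rfl⟩
      · rintro ⟨y, hy, rfl⟩
        exact ⟨_, ⟨y, hy, rfl⟩, rfl⟩

/-- Semidecidable maps compose: the truth value assigned to `a ∈ A(X)` is the set of points at which
`a` comes from `A''`; it is open as the direct image of an open set along a map onto the domain of
the outer subobject. -/
theorem isSemidecidable_comp {A'' A' A : GTopos} (n : A'' ⟶ A') (m : A' ⟶ A)
    (hn : IsSemidecidable trueG n) (hm : IsSemidecidable trueG m) :
    IsSemidecidable trueG (n ≫ m) := by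
  obtain ⟨ψ, hψ⟩ := hn
  obtain ⟨φ, hφ⟩ := hm
  have hn' := isPullback_true_iff.1 hψ
  have hm' := isPullback_true_iff.1 hφ
  have hopen : ∀ {X : SiteObj} (a : Sec A X),
      X.IsOpen {x | ∃ b : Sec A'' star, ap m (ap n b) = res (point x) a} := by
    intro X a
    have hsub : ∀ x, (∃ b : Sec A'' star, ap m (ap n b) = res (point x) a) →
        x ∈ carrier (ap φ a) := fun x ⟨b, hb⟩ =>
      (mem_carrier_classifier_iff hφ a x).2 ⟨ap n b, hb⟩
    rcases exists_range_eq (isOpen_carrier (ap φ a)) with h0 | ⟨Y, j, hj, hjo⟩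
    · convert isOpen_empty X
      exact Set.eq_empty_of_forall_notMem fun x hx => by
        have := hsub x hx
        rwa [h0] at this
    · obtain ⟨a', ha'⟩ := (hm'.2 Y (res j a)).2 (by
        rw [← res_ap, carrier_res, ← hj]
        exact Set.preimage_range _)
      convert hjo _ (isOpen_carrier (ap ψ a')) using 1
      ext x
      constructor
      · intro hx
        obtain ⟨y, rfl⟩ := hj.symm ▸ hsub x hx
        obtain ⟨b, hb⟩ := hx
        refine ⟨y, (mem_carrier_classifier_iff hψ a' y).2 ⟨b, hm'.1 _ _ _ ?_⟩, rfl⟩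
        rw [hb, ← res_ap, ha', res_point]
      · rintro ⟨y, hy, rfl⟩
        obtain ⟨b, hb⟩ := (mem_carrier_classifier_iff hψ a' y).1 hy
        exact ⟨b, by rw [hb, ← res_ap, ha', res_point]⟩
  refine ⟨homOfSec (fun X a => ofOpen _ (hopen a)) ?_, isPullback_true_iff.2 ⟨?_, ?_⟩⟩
  · intro X Y f a
    refine delta_ext (Set.ext fun y => ?_)
    change (∃ b : Sec A'' star, ap m (ap n b) = res (point (f.1 y)) a) ↔
      ∃ b : Sec A'' star, ap m (ap n b) = res (point y) (res f a)
    rw [res_point]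
  · intro X a b e
    exact hn'.1 _ _ _ (hm'.1 _ _ _ e)
  · intro X a
    constructor
    · rintro ⟨b, rfl⟩
      exact Set.eq_univ_of_forall fun x => ⟨res (point x) b, by rw [res_ap, ap_comp]⟩
    · intro h
      have h' : ∀ x, ∃ b : Sec A'' star, ap m (ap n b) = res (point x) a :=
        Set.eq_univ_iff_forall.1 h
      obtain ⟨a', rfl⟩ := (hm'.2 X a).2 (Set.eq_univ_of_forall fun x =>
        (mem_carrier_classifier_iff hφ a x).2 (by
          obtain ⟨b, hb⟩ := h' x
          exact ⟨_, hb⟩))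
      obtain ⟨b, rfl⟩ := (hn'.2 X a').2 (Set.eq_univ_of_forall fun x =>
        (mem_carrier_classifier_iff hψ a' x).2 (by
          obtain ⟨b, hb⟩ := h' x
          exact ⟨b, hm'.1 _ _ _ (by rw [hb, res_ap])⟩))
      exact ⟨b, rfl⟩

/-- The map `0 ⟶ A` is classified by the constantly empty truth value: this is true over `X` only
if `X` has no points, in which case every sheaf has exactly one section over `X`. -/
theorem isSemidecidable_initial_to (A : GTopos) : IsSemidecidable trueG (initial.to A) := by
  refine ⟨homOfSec (fun X _ => ofOpen ∅ (isOpen_empty X)) fun f a => rfl,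
    isPullback_iff.2 ⟨?_, ?_⟩⟩
  · intro X p
    exact congrArg (fun k => ap k p) (initialIsInitial.hom_ext (initial.to A ≫ homOfSec
      (fun X _ => ofOpen ∅ (isOpen_empty X)) fun f a => rfl) (toUnit _ ≫ trueG))
  · intro X a b e
    have hX : IsEmpty X.Pts := ⟨fun x => by
      have : (∅ : Set X.Pts) = Set.univ := congrArg carrier e
      have hx := Set.mem_univ x
      rwa [← this] at hx⟩
    obtain ⟨p⟩ := exists_sec_of_isEmpty (⊥_ GTopos) hX
    exact ⟨p, ⟨sec_ext_of_isEmpty hX _ _, sec_ext_of_isEmpty hX _ _⟩,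
      fun q _ => sec_ext_of_isEmpty hX _ _⟩

theorem isGenericSemidecidable_true : IsGenericSemidecidable trueG where
  existsUnique_classifier := fun _ ⟨φ, hφ⟩ => ⟨φ, hφ, fun _ hψ => classifier_unique hψ hφ⟩
  initial_to := isSemidecidable_initial_to
  comp := isSemidecidable_comp

/-! ### The lifting functor -/

section Lifting

variable {A B : GTopos} {X Y : SiteObj}

/-- The set of points at which a partial section is defined. -/
def supp (s : Sec (liftG.obj A) X) : Set X.Pts := carrier (PartialSection.dom s)

/-- The total section given by `a`. -/
def tot (a : Sec A X) : Sec (liftG.obj A) X := ap (unitG.app A) a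

/-- The domain of partial sections as a map `L A ⟶ Δ`. -/
def domMap (A : GTopos) : liftG.obj A ⟶ deltaG :=
  homOfSec (fun _ s => PartialSection.dom s) fun _ _ => rfl

theorem supp_res (f : Y ⟶ X) (s : Sec (liftG.obj A) X) : supp (res f s) = f.1 ⁻¹' supp s := rfl

theorem supp_tot (a : Sec A X) : supp (tot a) = Set.univ := rfl

theorem res_tot (f : Y ⟶ X) (a : Sec A X) : res f (tot a) = tot (res f a) :=
  res_ap (unitG.app A) f a

theorem ap_map_tot (φ : A ⟶ B) (a : Sec A X) : ap (liftG.map φ) (tot a) = tot (ap φ a) :=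
  (congrArg (fun k => ap k a) (unitG.naturality φ)).symm

theorem holds_of_supp {s : Sec (liftG.obj A) X} {f : Y ⟶ X} (h : ∀ y, f.1 y ∈ supp s) :
    Holds trueG (deltaG.obj.map f.op (PartialSection.dom s)) :=
  (holds_res_iff f).2 h

/-- The value of a partial section along a map with image in its domain. -/
def value (s : Sec (liftG.obj A) X) (f : Y ⟶ X) (h : ∀ y, f.1 y ∈ supp s) : Sec A Y :=
  PartialSection.val s f (holds_of_supp h)

theorem tot_injective : Function.Injective (tot (A := A) (X := X)) := fun a b e => by
  have h := PartialSection.val_congr' (t := trueG) (show PartialSection.total a =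
    PartialSection.total b from e) (f := 𝟙 X) (holds_iff.2 rfl) (holds_iff.2 rfl)
  exact (res_id a).symm.trans (h.trans (res_id b))

theorem res_eq_tot_value (s : Sec (liftG.obj A) X) (f : Y ⟶ X) (h : ∀ y, f.1 y ∈ supp s) :
    res f s = tot (value s f h) :=
  PartialSection.ext' (delta_ext (Set.eq_univ_of_forall h)) fun g _ _ =>
    (PartialSection.map_val s f g _ _).symm

theorem exists_eq_tot {s : Sec (liftG.obj A) X} (h : supp s = Set.univ) : ∃ a, s = tot a :=
  ⟨value s (𝟙 X) fun y => Set.eq_univ_iff_forall.1 h y,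
    (res_id s).symm.trans (res_eq_tot_value _ _ _)⟩

/-- Partial sections with the same domain are equal if they agree along the maps into the domain. -/
theorem lift_ext {s s' : Sec (liftG.obj A) X} (hd : supp s = supp s')
    (hv : ∀ {Y : SiteObj} (f : Y ⟶ X), (∀ y, f.1 y ∈ supp s) → res f s = res f s') : s = s' := by
  refine PartialSection.ext' (delta_ext hd) fun {Y} f h h' => tot_injective ?_
  have hs := (holds_res_iff f).1 h
  exact (res_eq_tot_value s f hs).symm.trans ((hv f hs).trans
    (res_eq_tot_value s' f ((holds_res_iff f).1 h')))

/-- A partial section is total if and only if its domain is true. -/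
theorem isPullback_unit_domMap (A : GTopos) :
    IsPullback (unitG.app A) (toUnit A) (domMap A) trueG :=
  isPullback_true_iff.2 ⟨fun _ _ _ e => tot_injective e, fun _ _ =>
    ⟨fun ⟨_, ha⟩ => ha ▸ rfl, fun h => (exists_eq_tot h).imp fun _ e => e.symm⟩⟩

theorem isPullback_unit_map (f : A ⟶ B) :
    IsPullback (unitG.app A) f (liftG.map f) (unitG.app B) := by
  refine isPullback_iff.2 ⟨fun X a => ap_map_tot f a, fun X s b e => ?_⟩
  obtain ⟨a, rfl⟩ := exists_eq_tot (s := s)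
    ((congrArg supp e : supp s = supp (tot b)).trans (supp_tot b))
  exact ⟨a, ⟨rfl, tot_injective ((ap_map_tot f a).symm.trans e)⟩, fun q hq => tot_injective hq.1⟩

/-- Partial maps with semidecidable domain `m : A' ⟶ A` are classified by `L`: over `a ∈ A(X)` the
classifying partial section has the truth value of `a` as domain and takes the values of `g` at the
unique preimages of the restrictions of `a` along `m`. -/
theorem existsUnique_lift_classifier {A' : GTopos} (m : A' ⟶ A) (g : A' ⟶ B)
    (hm : IsSemidecidable trueG m) : ∃! h : A ⟶ liftG.obj B, IsPullback m g h (unitG.app B) := by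
  obtain ⟨φ, hφ⟩ := hm
  obtain ⟨hinj, him⟩ := isPullback_true_iff.1 hφ
  have hex : ∀ {X Y : SiteObj} (a : Sec A X) (f : Y ⟶ X),
      Holds trueG (deltaG.obj.map f.op (ap φ a)) → ∃ a', ap m a' = res f a := fun a f h =>
    (him _ _).2 (by rw [← res_ap]; exact holds_iff.1 h)
  let F : ∀ X : SiteObj, Sec A X → Sec (liftG.obj B) X := fun X a =>
    { dom := ap φ a
      val := fun f h => ap g (hex a f h).choose
      map_val := fun f k h h' => by
        refine (res_ap g k _).trans (congrArg (ap g) (hinj _ _ _ ?_))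
        rw [← res_ap, (hex a f h).choose_spec, (hex a _ h').choose_spec, res_res] }
  have hF : ∀ {X Y : SiteObj} (f : Y ⟶ X) (a : Sec A X), res f (F X a) = F Y (res f a) := by
    intro X Y f a
    refine PartialSection.ext' (res_ap φ f a) fun k h h' => ?_
    refine congrArg (ap g) (hinj _ _ _ ?_)
    rw [(hex a (k ≫ f) (by rw [PartialSection.map_comp_apply]; exact h)).choose_spec,
      (hex (res f a) k h').choose_spec, res_res]
  have hFm : ∀ {X : SiteObj} (a' : Sec A' X), F X (ap m a') = tot (ap g a') := by
    intro X a'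
    refine PartialSection.ext' (delta_ext ((him _ _).1 ⟨a', rfl⟩)) fun k h h' => ?_
    refine Eq.trans (congrArg (ap g) (hinj _ _ (res k a') ?_)) (res_ap g k a').symm
    rw [(hex (ap m a') k h).choose_spec, res_ap]
  refine ⟨homOfSec F hF, isPullback_iff.2 ⟨fun X p => hFm p, fun X a b e => ?_⟩, fun h' hh' => ?_⟩
  · obtain ⟨a', rfl⟩ := (him X a).2 (congrArg supp e : supp (F X a) = supp (tot b))
    exact ⟨a', ⟨rfl, tot_injective ((hFm a').symm.trans e)⟩, fun q hq => hinj _ _ _ hq.1⟩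
  · have hd : h' ≫ domMap B = φ := by
      refine classifier_unique (m := m) ?_ hφ
      rw [toUnit_unique (toUnit A') (g ≫ toUnit B)]
      exact hh'.paste_vert (isPullback_unit_domMap B)
    have hm' : ∀ {X : SiteObj} (a' : Sec A' X), ap h' (ap m a') = tot (ap g a') :=
      fun {X} a' => (isPullback_iff.1 hh').1 X a'
    refine hom_ext_ap fun X a => lift_ext ?_ fun {Y} f hf => ?_
    · exact congrArg carrier (congrArg (fun k => ap k a) hd)
    · obtain ⟨a', ha'⟩ := (him _ (res f a)).2 (by
        rw [← res_ap, ← hd]; exact Set.eq_univ_of_forall hf)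
      rw [res_ap, ← ha', hm', res_ap, ← ha']
      exact (hFm a').symm

theorem isLifting_liftG : IsLifting trueG liftG unitG where
  semidecidable B := ⟨_, isPullback_unit_domMap B⟩
  existsUnique_classifier := existsUnique_lift_classifier
  isPullback_map := isPullback_unit_map

theorem isBottom_botG : IsBottom unitG botG := by
  refine isPullback_iff.2 ⟨fun X p => ?_, fun X a b e => ?_⟩
  · exact congrArg (fun k => ap k p) (initialIsInitial.hom_ext
      (initial.to (𝟙_ GTopos) ≫ botG) (initial.to (𝟙_ GTopos) ≫ unitG.app (𝟙_ GTopos)))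
  · have hX : IsEmpty X.Pts := ⟨fun x => by
      have : (∅ : Set X.Pts) = Set.univ := congrArg supp e
      have hx := Set.mem_univ x
      rwa [← this] at hx⟩
    obtain ⟨p⟩ := exists_sec_of_isEmpty (⊥_ GTopos) hX
    exact ⟨p, ⟨sec_unit_eq _ _, sec_unit_eq _ _⟩, fun q _ => sec_ext_of_isEmpty hX _ _⟩

end Lifting

/-! ### The natural numbers object and its lifting -/

/-- The section of `N` with constant value `k`. -/
noncomputable def numeral (k : ℕ) (X : SiteObj) : Sec natG X :=
  ap (Sigma.ι (fun _ : ℕ => 𝟙_ GTopos) k) (PUnit.unit : PUnit.{2})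

theorem res_numeral (k : ℕ) {X Y : SiteObj} (f : Y ⟶ X) :
    res f (numeral k X) = numeral k Y :=
  res_ap (Sigma.ι (fun _ : ℕ => 𝟙_ GTopos) k) f (PUnit.unit : PUnit.{2})

theorem exists_cover_numeral {X : SiteObj} (x : Sec natG X) :
    ∃ S ∈ SiteObj.cov.toGrothendieck X, ∀ {Y : SiteObj} (f : Y ⟶ X), S f →
      ∃ k, res f x = numeral k Y := by
  obtain ⟨S, hS, h⟩ := exists_cover_of_isColimit
    (colimit.isColimit (Discrete.functor fun _ : ℕ => 𝟙_ GTopos)) x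
  refine ⟨S, hS, fun f hf => ?_⟩
  obtain ⟨⟨k⟩, d, hd⟩ := h f hf
  exact ⟨k, hd.symm.trans (congrArg (ap (Sigma.ι (fun _ : ℕ => 𝟙_ GTopos) k)) (sec_unit_eq d _))⟩

/-- Numerals are told apart over `⋆` by the maps `N ⟶ L 1` sending one numeral to `⊤` and the
others to `⊥`. -/
theorem numeral_injective {k l : ℕ} (h : numeral k star = numeral l star) : k = l := by
  by_contra hkl
  let c : ℕ → (𝟙_ GTopos ⟶ liftG.obj (𝟙_ GTopos)) := fun j =>
    if j = k then unitG.app (𝟙_ GTopos) else botG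
  let u : Sec (𝟙_ GTopos) star := (PUnit.unit : PUnit.{2})
  have hc : ∀ j, ap (Limits.Sigma.desc c) (numeral j star) = ap (c j) u := fun j => by
    rw [← Sigma.ι_desc c j]; rfl
  have hk := hc k
  have hl := hc l
  rw [show c k = unitG.app (𝟙_ GTopos) from if_pos rfl] at hk
  rw [show c l = botG from if_neg (Ne.symm hkl), ← h, hk] at hl
  have : (Set.univ : Set Unit) = ∅ := congrArg supp hl
  exact Set.notMem_empty () (this ▸ Set.mem_univ ())

/-- Sections of `N` are determined by their restrictions to points: two sections are locally
numerals, and these agree wherever there is a point; an object without points is covered by the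
empty family, so it has only one section. -/
theorem nat_ext {X : SiteObj} {a b : Sec natG X}
    (h : ∀ x, res (point x) a = res (point x) b) : a = b := by
  obtain ⟨S, hS, ha⟩ := exists_cover_numeral a
  obtain ⟨T, hT, hb⟩ := exists_cover_numeral b
  refine sec_ext_of_mem (SiteObj.cov.toGrothendieck.intersection_covering hS hT)
    fun {Y} f hf => ?_
  rcases isEmpty_or_nonempty Y.Pts with hY | ⟨⟨y⟩⟩
  · exact sec_ext_of_isEmpty hY _ _
  · obtain ⟨k, hk⟩ := ha f hf.1
    obtain ⟨l, hl⟩ := hb f hf.2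
    have hy := h (f.1 y)
    rw [← res_point, ← res_point, hk, hl, res_numeral, res_numeral] at hy
    rw [hk, hl, numeral_injective hy]

/-- As `V` has no proper covers, sections of `N` over `V` are constant. -/
theorem exists_eq_numeral (a : Sec natG vert) : ∃ k, a = numeral k vert := by
  obtain ⟨S, hS, h⟩ := exists_cover_numeral a
  obtain rfl := covering_eq_top hS (.inr rfl)
  obtain ⟨k, hk⟩ := h (𝟙 vert) trivial
  exact ⟨k, (res_id a).symm.trans hk⟩

theorem mem_supp_iff {A : GTopos} {X : SiteObj} {s : Sec (liftG.obj A) X} {x : X.Pts} :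
    x ∈ supp s ↔ (supp (res (point x) s)).Nonempty :=
  ⟨fun h => ⟨(), h⟩, fun ⟨_, h⟩ => h⟩

/-- Sections of `L N` are determined by their restrictions to points. -/
theorem lift_nat_ext {X : SiteObj} {s s' : Sec (liftG.obj natG) X}
    (h : ∀ x, res (point x) s = res (point x) s') : s = s' := by
  have hd : supp s = supp s' := Set.ext fun x => by rw [mem_supp_iff, mem_supp_iff, h]
  refine lift_ext hd fun {Y} f hf => ?_
  rw [res_eq_tot_value s f hf, res_eq_tot_value s' f (hd ▸ hf)]
  refine congrArg tot (nat_ext fun y => tot_injective ?_)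
  rw [← res_tot, ← res_tot, ← res_eq_tot_value, ← res_eq_tot_value, res_point, res_point, h]

theorem eq_of_supp_eq_empty {A : GTopos} {X : SiteObj} {s s' : Sec (liftG.obj A) X}
    (h : supp s = ∅) (h' : supp s' = ∅) : s = s' :=
  lift_ext (h.trans h'.symm) fun {Y} _ hf => sec_ext_of_isEmpty ⟨fun y : Y.Pts => by
    have := hf y
    rwa [h] at this⟩ _ _

/-- The point `p` of `V`. -/
abbrev vpt (p : ℕ∞) : star ⟶ vert := point (X := vert) p

/-- A section of `L N` over `V` is a constant defined on some `{n, n + 1, …, ∞}`, or undefined. -/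
theorem lift_nat_vert (s : Sec (liftG.obj natG) vert) :
    (∀ p, supp (res (vpt p) s) = ∅) ∨ ∃ n k : ℕ, ∀ p : ℕ∞,
      ((n : ℕ∞) ≤ p → res (vpt p) s = tot (numeral k star)) ∧
      (¬ (n : ℕ∞) ≤ p → supp (res (vpt p) s) = ∅) := by
  have hs : supp s = ∅ ∨ ∃ n : ℕ, supp s = (Set.Ici (n : ℕ∞) : Set ℕ∞) :=
    isOpen_carrier (PartialSection.dom s)
  rcases hs with h | ⟨n, h⟩
  · exact .inl fun p => by rw [supp_res, h]; rfl
  · have hsh : ∀ p, (shift n).1 p ∈ supp s := fun p => by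
      rw [h]
      exact (le_add_self : (n : ℕ∞) ≤ (show ℕ∞ from p) + (n : ℕ∞))
    obtain ⟨k, hk⟩ := exists_eq_numeral (value s (shift n) hsh)
    refine .inr ⟨n, k, fun p => ⟨fun hp => ?_, fun hp => ?_⟩⟩
    · have e : vpt p = vpt (p - (n : ℕ∞)) ≫ shift n :=
        congrArg vpt (tsub_add_cancel_of_le hp).symm
      rw [e, ← res_res, res_eq_tot_value s _ hsh, hk, res_tot, res_numeral]
    · rw [supp_res, h]
      exact Set.eq_empty_of_forall_notMem fun _ hx => hp hx

/-- Along `p ≤ q` in `V`, a section of `L N` either is undefined at `p` or has the same value at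
`p` and `q`. -/
theorem lift_nat_vert_mono (s : Sec (liftG.obj natG) vert) {p q : ℕ∞} (h : p ≤ q) :
    supp (res (vpt p) s) = ∅ ∨ res (vpt p) s = res (vpt q) s := by
  rcases lift_nat_vert s with h0 | ⟨n, k, hn⟩
  · exact .inl (h0 p)
  · by_cases hp : (n : ℕ∞) ≤ p
    · exact .inr (((hn p).1 hp).trans ((hn q).1 (hp.trans h)).symm)
    · exact .inl ((hn p).2 hp)

/-- The value of a section of `L N` at `∞` is attained from some finite stage on. -/
theorem lift_nat_vert_top (s : Sec (liftG.obj natG) vert) :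
    ∃ n : ℕ, ∀ p : ℕ∞, (n : ℕ∞) ≤ p → res (vpt p) s = res (vpt ⊤) s := by
  rcases lift_nat_vert s with h0 | ⟨n, k, hn⟩
  · exact ⟨0, fun p _ => eq_of_supp_eq_empty (h0 p) (h0 ⊤)⟩
  · exact ⟨n, fun p hp => ((hn p).1 hp).trans ((hn ⊤).1 le_top).symm⟩

/-- A section of `L N` over `V` is determined by its values at the finite points. -/
theorem lift_nat_vert_eq_top {s s' : Sec (liftG.obj natG) vert}
    (h : ∀ n : ℕ, res (vpt n) s = res (vpt n) s') : res (vpt ⊤) s = res (vpt ⊤) s' := by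
  obtain ⟨n, hn⟩ := lift_nat_vert_top s
  obtain ⟨m, hm⟩ := lift_nat_vert_top s'
  rw [← hn (max n m : ℕ) (Nat.cast_le.2 (le_max_left _ _)),
    ← hm (max n m : ℕ) (Nat.cast_le.2 (le_max_right _ _)), h]

/-- An increasing sequence of sections of `L N`: at each point, the value at one stage is undefined
or equal to the value at the next stage. -/
def IsChain {X : SiteObj} (s : ℕ → Sec (liftG.obj natG) X) : Prop :=
  ∀ n x, supp (res (point x) (s n)) = ∅ ∨ res (point x) (s n) = res (point x) (s (n + 1))

theorem IsChain.eq_of_le {X : SiteObj} {s : ℕ → Sec (liftG.obj natG) X} (hs : IsChain s)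
    {n m : ℕ} (h : n ≤ m) {x : X.Pts} (hx : supp (res (point x) (s n)) ≠ ∅) :
    res (point x) (s m) = res (point x) (s n) := by
  induction m, h using Nat.le_induction with
  | base => rfl
  | succ m _ ih =>
    rcases hs m x with h | h
    · rw [ih] at h
      exact (hx h).elim
    · exact h.symm.trans ih

theorem IsChain.eventually_point {X : SiteObj} {s : ℕ → Sec (liftG.obj natG) X} (hs : IsChain s)
    (x : X.Pts) : ∃ c, ∀ᶠ n in Filter.atTop, res (point x) (s n) = c := by
  by_cases h : ∃ n, supp (res (point x) (s n)) ≠ ∅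
  · obtain ⟨n, hn⟩ := h
    exact ⟨_, Filter.eventually_atTop.2 ⟨n, fun m hm => hs.eq_of_le hm hn⟩⟩
  · push Not at h
    exact ⟨_, Filter.Eventually.of_forall fun n => eq_of_supp_eq_empty (h n) (h 0)⟩

/-- It suffices that a chain stabilises uniformly away from a finite set of points. -/
theorem IsChain.eventually_of_finite {X : SiteObj} {s : ℕ → Sec (liftG.obj natG) X}
    (hs : IsChain s) {T : Set X.Pts} (hT : T.Finite)
    (h : ∃ n₀, ∀ n ≥ n₀, ∀ x ∉ T, res (point x) (s n) = res (point x) (s n₀)) :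
    ∃ c, ∀ᶠ n in Filter.atTop, s n = c := by
  choose c hc using hs.eventually_point
  have h1 : ∀ᶠ n in Filter.atTop, ∀ x ∈ T, res (point x) (s n) = c x :=
    (Filter.eventually_all_finite hT).2 fun x _ => hc x
  obtain ⟨n₀, h0⟩ := h
  obtain ⟨n₁, h1⟩ := Filter.eventually_atTop.1 h1
  refine ⟨s (max n₀ n₁), Filter.eventually_atTop.2
    ⟨max n₀ n₁, fun n hn => lift_nat_ext fun x => ?_⟩⟩
  by_cases hx : x ∈ T
  · rw [h1 n (le_trans (le_max_right _ _) hn) x hx, h1 _ (le_max_right _ _) x hx]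
  · rw [h0 n (le_trans (le_max_left _ _) hn) x hx, h0 _ (le_max_left _ _) x hx]

/-- Chains in `(L N)(X)` stabilise. Over `(c, U)` there are finitely many points. Over `V`, once a
section of the chain is defined at `∞`, it is defined at all but finitely many points, and the
chain is stationary there. -/
theorem IsChain.eventually_eq {X : SiteObj} {s : ℕ → Sec (liftG.obj natG) X} (hs : IsChain s) :
    ∃ c, ∀ᶠ n in Filter.atTop, s n = c := by
  have fin : Finite X.Pts → ∃ c, ∀ᶠ n in Filter.atTop, s n = c := fun _ =>
    hs.eventually_of_finite (Set.toFinite Set.univ) ⟨0, fun _ _ x hx => (hx trivial).elim⟩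
  cases X with
  | star => exact fin (inferInstanceAs (Finite Unit))
  | part i c U hU =>
    have := (i.F.obj c).finite
    exact fin (inferInstanceAs (Finite U))
  | vert =>
    by_cases h : ∃ n, supp (res (vpt ⊤) (s n)) ≠ ∅
    · obtain ⟨n₀, h0⟩ := h
      obtain ⟨m, hm⟩ := lift_nat_vert_top (s n₀)
      refine hs.eventually_of_finite (T := (Set.Iio (m : ℕ∞) : Set ℕ∞)) ?_
        ⟨n₀, fun n hn x hx => hs.eq_of_le hn ?_⟩
      · exact (Set.finite_lt_nat m).image (Nat.cast : ℕ → ℕ∞) |>.subset fun x hx => by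
          obtain ⟨j, rfl⟩ := ENat.ne_top_iff_exists.1 (ne_top_of_lt hx)
          exact ⟨j, Nat.cast_lt.1 (show (j : ℕ∞) < (m : ℕ∞) from hx), rfl⟩
      · have := hm x (not_lt.1 hx)
        rwa [this]
    · push Not at h
      refine hs.eventually_of_finite Set.finite_empty ⟨0, fun n _ x _ => ?_⟩
      have hb : ∀ n, supp (res (vpt x) (s n)) = ∅ := fun n =>
        (lift_nat_vert_mono (s n) (le_top (a := (show ℕ∞ from x)))).elim id
          fun e => e ▸ h n
      exact eq_of_supp_eq_empty (hb n) (hb 0)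

/-! ### The objects `Lⁿ 1`, `ω` and `ω̄` -/

section Partial

variable {A B : GTopos} {X Y : SiteObj}

/-- The restriction of a total section to an open domain. -/
def restr (U : Set X.Pts) (hU : X.IsOpen U) (b : Sec A X) : Sec (liftG.obj A) X where
  dom := ofOpen U hU
  val f _ := res f b
  map_val f g _ _ := res_res f g b

theorem res_restr_of_mem (U : Set X.Pts) (hU : X.IsOpen U) (b : Sec A X) (f : Y ⟶ X)
    (h : ∀ y, f.1 y ∈ U) : res f (restr U hU b) = tot (res f b) :=
  res_eq_tot_value (restr U hU b) f h

theorem ap_map_restr (φ : A ⟶ B) (U : Set X.Pts) (hU : X.IsOpen U) (b : Sec A X) :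
    ap (liftG.map φ) (restr U hU b) = restr U hU (ap φ b) :=
  PartialSection.ext' rfl fun f _ _ => (res_ap φ f b).symm

theorem supp_eq_empty_or_exists_eq_tot (s : Sec (liftG.obj A) star) :
    supp s = ∅ ∨ ∃ a, s = tot a := by
  rcases (supp s).eq_empty_or_nonempty with h | ⟨⟨⟩, h⟩
  · exact .inl h
  · exact .inr (exists_eq_tot (Set.eq_univ_of_forall fun _ => h))

theorem supp_bot (u : Sec (𝟙_ GTopos) X) : supp (ap botG u) = ∅ := rfl

end Partial

/-- The map `V ⟶ ⋆`. -/
def toStar : vert ⟶ star := ⟨fun _ => (), .const _ fun _ _ => rfl⟩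

theorem res_vpt_toStar {A : GTopos} (p : ℕ∞) (a : Sec A star) :
    res (vpt p) (res toStar a) = a :=
  (res_res _ _ _).trans (res_id a)

theorem isOpen_Ici_one : SiteObj.IsOpen vert (Set.Ici (1 : ℕ∞) : Set ℕ∞) :=
  .inr ⟨1, rfl⟩

/-- The relation `a ⊑ b` between points of a sheaf: there is a section over `V` with value `a` at
`0` and value `b` at `1`. Every map of sheaves preserves it. -/
def PathLE {A : GTopos} (a b : Sec A star) : Prop :=
  ∃ v : Sec A vert, res (vpt 0) v = a ∧ res (vpt 1) v = b

theorem PathLE.refl {A : GTopos} (a : Sec A star) : PathLE a a :=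
  ⟨res toStar a, res_vpt_toStar _ _, res_vpt_toStar _ _⟩

theorem PathLE.map {A B : GTopos} (φ : A ⟶ B) {a b : Sec A star} (h : PathLE a b) :
    PathLE (ap φ a) (ap φ b) := by
  obtain ⟨v, rfl, rfl⟩ := h
  exact ⟨ap φ v, res_ap _ _ _, res_ap _ _ _⟩

theorem PathLE.pair {A B : GTopos} (c : Sec A star) {a b : Sec B star} (h : PathLE a b) :
    PathLE (pair c a) (pair c b) := by
  obtain ⟨v, rfl, rfl⟩ := h
  exact ⟨PCFv.pair (res toStar c) v, by rw [res_pair, res_vpt_toStar],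
    by rw [res_pair, res_vpt_toStar]⟩

/-- A point of `Lⁿ⁺¹ 1` lies above its truncation at level `n`. -/
theorem pathLE_extend_collapse : ∀ (n : ℕ) (w : Sec (liftPow liftG (n + 1)) star),
    PathLE (ap (extend liftG botG n) (ap (collapse liftG n) w)) w
  | 0, w => by
    rcases supp_eq_empty_or_exists_eq_tot (A := 𝟙_ GTopos) w with h | ⟨a, rfl⟩
    · have e : ap (extend liftG botG 0) (ap (collapse liftG 0) w) = w :=
        eq_of_supp_eq_empty (A := 𝟙_ GTopos) (supp_bot _) h
      rw [e]
      exact .refl w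
    · refine ⟨restr (A := 𝟙_ GTopos) _ isOpen_Ici_one (res toStar a), ?_, ?_⟩
      · refine eq_of_supp_eq_empty (A := 𝟙_ GTopos) ?_ (supp_bot _)
        exact Set.eq_empty_of_forall_notMem fun _ (h : (1 : ℕ∞) ≤ 0) => by simp at h
      · refine (res_restr_of_mem (A := 𝟙_ GTopos) _ isOpen_Ici_one _ (vpt 1)
          fun _ => le_refl (1 : ℕ∞)).trans ?_
        exact congrArg tot (sec_unit_eq _ a)
  | n + 1, w => by
    rcases supp_eq_empty_or_exists_eq_tot (A := liftPow liftG (n + 1)) w with h | ⟨a, rfl⟩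
    · have e : ap (extend liftG botG (n + 1)) (ap (collapse liftG (n + 1)) w) = w :=
        eq_of_supp_eq_empty (A := liftPow liftG (n + 1)) h h
      rw [e]
      exact .refl w
    · have h := (pathLE_extend_collapse n a).map (unitG.app (liftPow liftG (n + 1)))
      have e : ap (extend liftG botG (n + 1)) (ap (collapse liftG (n + 1)) (tot a)) =
          tot (ap (extend liftG botG n) (ap (collapse liftG n) a)) :=
        (congrArg (ap (liftG.map (extend liftG botG n))) (ap_map_tot _ a)).trans (ap_map_tot _ _)
      rw [e]
      exact h

/-- The truncated predecessor on `V`. -/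
def pred : vert ⟶ vert :=
  ⟨fun x : ℕ∞ => x - 1, .vert _ <| by
    intro d _ _ a ha
    refine ⟨?_, fun b hb => tsub_le_iff_right.2 (ha.2 fun x hx => ?_)⟩
    · rintro _ ⟨x, hx, rfl⟩
      exact tsub_le_tsub_right (ha.1 hx) _
    · exact tsub_le_iff_right.1 (hb ⟨x, hx, rfl⟩)⟩

theorem vpt_succ_pred (m : ℕ) : vpt ((m + 1 : ℕ) : ℕ∞) ≫ pred = vpt m :=
  congrArg vpt (show ((m + 1 : ℕ) : ℕ∞) - 1 = m by
    rw [Nat.cast_add, Nat.cast_one]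
    exact (ENat.addLECancellable_of_ne_top ENat.one_ne_top).add_tsub_cancel_right)

theorem vpt_top_pred : vpt ⊤ ≫ pred = vpt ⊤ :=
  congrArg vpt (show (⊤ : ℕ∞) - 1 = ⊤ from rfl)

open Classical in
/-- For a function `F` from points of `A` to sections over `V`, the function on points of `L A` that
sends the undefined point to the undefined section, and a total point `a` to the section that is
undefined at `0` and has value `F a m` at `m + 1`. -/
noncomputable def spreadStep {A : GTopos} (F : Sec A star → Sec A vert)
    (w : Sec (liftG.obj A) star) : Sec (liftG.obj A) vert :=
  if h : ∃ a, w = tot a then restr _ isOpen_Ici_one (res pred (F h.choose)) else res toStar w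

theorem spreadStep_tot {A : GTopos} (F : Sec A star → Sec A vert) (a : Sec A star) :
    spreadStep F (tot a) = restr _ isOpen_Ici_one (res pred (F a)) := by
  have h : ∃ b, tot a = tot b := ⟨a, rfl⟩
  rw [spreadStep, dif_pos h, ← tot_injective h.choose_spec]

theorem spreadStep_of_supp_eq_empty {A : GTopos} (F : Sec A star → Sec A vert)
    {w : Sec (liftG.obj A) star} (hw : supp w = ∅) : spreadStep F w = res toStar w := by
  rw [spreadStep, dif_neg]
  rintro ⟨a, rfl⟩
  exact Set.notMem_empty () (hw ▸ Set.mem_univ ())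

/-- The section of `Lⁿ 1` over `V` whose value at `m` is the point `w` truncated at `m`, and whose
value at `∞` is `w`. -/
noncomputable def spread : ∀ n : ℕ, Sec (liftPow liftG n) star → Sec (liftPow liftG n) vert
  | 0 => fun _ => (PUnit.unit : PUnit.{2})
  | n + 1 => spreadStep (spread n)

theorem spread_tot (n : ℕ) (a : Sec (liftPow liftG n) star) :
    spread (n + 1) (tot a) =
      restr (A := liftPow liftG n) _ isOpen_Ici_one (res pred (spread n a)) :=
  spreadStep_tot _ a

theorem spread_of_supp_eq_empty (n : ℕ) {w : Sec (liftPow liftG (n + 1)) star}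
    (hw : supp (A := liftPow liftG n) w = ∅) : spread (n + 1) w = res toStar w :=
  spreadStep_of_supp_eq_empty _ hw

theorem ap_collapse_spread : ∀ (n : ℕ) (w : Sec (liftPow liftG (n + 1)) star),
    ap (collapse liftG n) (spread (n + 1) w) = spread n (ap (collapse liftG n) w)
  | 0, _ => sec_unit_eq _ _
  | n + 1, w => by
    rcases supp_eq_empty_or_exists_eq_tot (A := liftPow liftG (n + 1)) w with h | ⟨a, rfl⟩
    · rw [spread_of_supp_eq_empty _ h, spread_of_supp_eq_empty n
        (w := ap (collapse liftG (n + 1)) w) h, res_ap]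
    · have e : ap (collapse liftG (n + 1)) (tot a) = tot (ap (collapse liftG n) a) := ap_map_tot _ a
      rw [spread_tot, e, spread_tot, ← ap_collapse_spread n a, res_ap]
      exact ap_map_restr _ _ _ _

theorem res_top_spread : ∀ (n : ℕ) (w : Sec (liftPow liftG n) star),
    res (vpt ⊤) (spread n w) = w
  | 0, _ => sec_unit_eq _ _
  | n + 1, w => by
    rcases supp_eq_empty_or_exists_eq_tot (A := liftPow liftG n) w with h | ⟨a, rfl⟩
    · rw [spread_of_supp_eq_empty _ h, res_vpt_toStar]
    · rw [spread_tot]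
      refine (res_restr_of_mem (A := liftPow liftG n) _ _ _ (vpt ⊤)
        fun _ => (le_top : (1 : ℕ∞) ≤ ⊤)).trans ?_
      rw [res_res, vpt_top_pred, res_top_spread n a]

theorem res_spread : ∀ (m n : ℕ) (w : Sec (liftPow liftG n) star),
    res (vpt m) (spread n w) = ap (compare liftG botG m n) (ap (compare liftG botG n m) w)
  | _, 0, _ => sec_unit_eq _ _
  | 0, n + 1, w => by
    refine eq_of_supp_eq_empty (A := liftPow liftG n) ?_
      (supp_bot (X := star) (PUnit.unit : PUnit.{2}))
    rcases supp_eq_empty_or_exists_eq_tot (A := liftPow liftG n) w with h | ⟨a, rfl⟩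
    · rw [spread_of_supp_eq_empty _ h, res_vpt_toStar, h]
    · rw [spread_tot]
      exact Set.eq_empty_of_forall_notMem fun _ (h : (1 : ℕ∞) ≤ (0 : ℕ)) => by simp at h
  | m + 1, n + 1, w => by
    rcases supp_eq_empty_or_exists_eq_tot (A := liftPow liftG n) w with h | ⟨a, rfl⟩
    · rw [spread_of_supp_eq_empty _ h, res_vpt_toStar]
      exact eq_of_supp_eq_empty (A := liftPow liftG n) h h
    · rw [spread_tot]
      refine (res_restr_of_mem (A := liftPow liftG n) _ _ _ (vpt (m + 1 : ℕ))
        fun _ => show (1 : ℕ∞) ≤ (m + 1 : ℕ) from by simp).trans ?_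
      rw [res_res, vpt_succ_pred, res_spread m n a]
      exact ((congrArg (ap (liftG.map (compare liftG botG m n))) (ap_map_tot _ a)).trans
        (ap_map_tot _ _)).symm

/-- The projection `ω̄ ⟶ Lⁿ 1`. -/
noncomputable def barProj (n : ℕ) : omegaBar liftG ⟶ liftPow liftG n :=
  limit.π (Functor.ofOpSequence (collapse liftG)) (op n)

/-- The inclusion `Lⁿ 1 ⟶ ω`. -/
noncomputable def omegaIn (n : ℕ) : liftPow liftG n ⟶ omega liftG botG :=
  colimit.ι (Functor.ofSequence (extend liftG botG)) n

theorem barProj_collapse (n : ℕ) : barProj (n + 1) ≫ collapse liftG n = barProj n := by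
  have := limit.w (Functor.ofOpSequence (collapse liftG)) (homOfLE (n.le_add_right 1)).op
  rwa [Functor.ofOpSequence_map_homOfLE_succ] at this

theorem extend_omegaIn (n : ℕ) : extend liftG botG n ≫ omegaIn (n + 1) = omegaIn n := by
  have := colimit.w (Functor.ofSequence (extend liftG botG)) (homOfLE (n.le_add_right 1))
  rwa [Functor.ofSequence_map_homOfLE_succ] at this

theorem omegaIn_inclusion_barProj (m n : ℕ) :
    omegaIn m ≫ omegaInclusion liftG botG ≫ barProj n = compare liftG botG m n := by
  have h : omegaIn m ≫ omegaInclusion liftG botG = toOmegaBar liftG botG m := colimit.ι_desc _ _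
  rw [← Category.assoc, h]
  exact toOmegaBar_π liftG botG m (op n)

theorem barProj_compare {m n : ℕ} (h : n ≤ m) :
    barProj m ≫ compare liftG botG m n = barProj n := by
  induction m, h using Nat.le_induction with
  | base => rw [compare_self, Category.comp_id]
  | succ m h ih => rw [compare_succ_left _ _ _ _ h, ← Category.assoc, barProj_collapse, ih]

theorem compare_omegaIn {m n : ℕ} (h : m ≤ n) :
    compare liftG botG m n ≫ omegaIn n = omegaIn m := by
  induction n, h using Nat.le_induction with
  | base => rw [compare_self, Category.id_comp]
  | succ n h ih => rw [compare_succ_right _ _ _ _ h, Category.assoc, extend_omegaIn, ih]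

theorem exists_cover_omegaIn {X : SiteObj} (w : Sec (omega liftG botG) X) :
    ∃ S ∈ SiteObj.cov.toGrothendieck X, ∀ {Y : SiteObj} (f : Y ⟶ X), S f →
      ∃ (m : ℕ) (d : Sec (liftPow liftG m) Y), ap (omegaIn m) d = res f w :=
  exists_cover_of_isColimit (colimit.isColimit _) w

theorem compare_compare : ∀ {m n : ℕ}, m ≤ n →
    compare liftG botG m n ≫ compare liftG botG n m = 𝟙 _
  | 0, _, _ => toUnit_unique _ _
  | _ + 1, _ + 1, h =>
    ((liftG.map_comp _ _).symm.trans (congrArg liftG.map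
      (compare_compare (Nat.le_of_succ_le_succ h)))).trans (liftG.map_id _)

/-- Sections of `ω̄` are compatible sequences of sections of the `Lⁿ 1`. -/
theorem existsUnique_omegaBar {X : SiteObj} (x : ∀ n, Sec (liftPow liftG n) X)
    (hx : ∀ n, ap (collapse liftG n) (x (n + 1)) = x n) :
    ∃! v : Sec (omegaBar liftG) X, ∀ n, ap (barProj n) v = x n := by
  let F := Functor.ofOpSequence (collapse liftG)
  let ev := sheafToPresheaf SiteObj.cov.toGrothendieck (Type 1) ⋙ (evaluation _ _).obj (op X)
  have hl := isLimitOfPreserves ev (limit.isLimit F)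
  let c : Cone (F ⋙ ev) :=
    { pt := PUnit.{2}
      π := NatTrans.ofOpSequence (fun n => ↾(fun _ => x n)) fun n => by
        ext u
        have := hx n
        simp only [Functor.comp_map, F]
        rw [Functor.ofOpSequence_map_homOfLE_succ]
        exact this.symm }
  refine ⟨hl.lift c PUnit.unit, fun n => ?_, fun v hv => ?_⟩
  · exact congrArg (fun k => k PUnit.unit) (hl.fac c (op n))
  · have h : (↾(fun _ : PUnit.{2} => v) : c.pt ⟶ ev.obj (limit F)) = hl.lift c :=
      hl.uniq c _ fun j => by
        ext u
        exact hv j.unop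
    exact congrArg (fun k => k PUnit.unit) h

theorem omegaBar_ext {X : SiteObj} {u v : Sec (omegaBar liftG) X}
    (h : ∀ n, ap (barProj n) u = ap (barProj n) v) : u = v :=
  (existsUnique_omegaBar (fun n => ap (barProj n) v) fun n =>
    congrArg (fun k => ap k v) (barProj_collapse n)).unique h fun _ => rfl

/-- Every point of `ω̄` is the value at `∞` of a section over `V` whose values at the finite points
come from `ω`. -/
theorem exists_section_vert (u : Sec (omegaBar liftG) star) :
    ∃ v : Sec (omegaBar liftG) vert, res (vpt ⊤) v = u ∧
      ∀ m : ℕ, ∃ w, res (vpt m) v = ap (omegaInclusion liftG botG) w := by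
  obtain ⟨v, hv, -⟩ := existsUnique_omegaBar (fun n => spread n (ap (barProj n) u)) fun n => by
    rw [ap_collapse_spread, ← ap_comp, barProj_collapse]
  refine ⟨v, omegaBar_ext fun n => ?_, fun m => ⟨ap (omegaIn m ) (ap (barProj m) u),
    omegaBar_ext fun n => ?_⟩⟩
  · rw [← res_ap, hv, res_top_spread]
  · rw [← res_ap, hv, res_spread, ← ap_comp, ← ap_comp (omegaInclusion liftG botG),
      ← ap_comp (omegaIn m), omegaIn_inclusion_barProj, ← ap_comp (barProj m)]
    rcases le_total m n with h | h
    · rw [ap_comp, ← ap_comp (barProj n), barProj_compare h, ap_comp]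
    · rw [compare_compare h, barProj_compare h, ap_id]

/-! ### Completeness -/

/-- Maps into `L N` extend along `A × ω ⟶ A × ω̄`, by the eventual value of the sequence of their
composites with the truncations of `ω̄`. -/
theorem exists_extension {A : GTopos} (f : A ⊗ omega liftG botG ⟶ liftG.obj natG) :
    ∃ g : A ⊗ omegaBar liftG ⟶ liftG.obj natG, (A ◁ omegaInclusion liftG botG) ≫ g = f := by
  let s : ∀ {X : SiteObj}, Sec (A ⊗ omegaBar liftG) X → ℕ → Sec (liftG.obj natG) X :=
    fun p n => ap ((A ◁ (barProj n ≫ omegaIn n)) ≫ f) p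
  have hres : ∀ {X Y : SiteObj} (k : Y ⟶ X) (p : Sec (A ⊗ omegaBar liftG) X) (n : ℕ),
      res k (s p n) = s (res k p) n := fun k p n => res_ap _ _ _
  -- Consecutive truncations are joined by a section over `V`, which `f` sends to one of `L N`.
  have hchain : ∀ {X : SiteObj} (p : Sec (A ⊗ omegaBar liftG) X), IsChain (s p) := by
    intro X p n x
    rw [hres, hres]
    obtain ⟨a, u, e⟩ := exists_pair (res (point x) p)
    rw [e]
    have h := ((pathLE_extend_collapse n (ap (barProj (n + 1)) u)).map (omegaIn (n + 1))).pair a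
    rw [← ap_comp (barProj (n + 1)), barProj_collapse, ← ap_comp (extend liftG botG n),
      extend_omegaIn] at h
    obtain ⟨v, h0, h1⟩ := h.map f
    have := lift_nat_vert_mono v (p := 0) (q := 1) zero_le_one
    rwa [h0, h1] at this
  choose G hG using fun (X : SiteObj) (p : Sec (A ⊗ omegaBar liftG) X) => (hchain p).eventually_eq
  have huniq : ∀ {X : SiteObj} (p : Sec (A ⊗ omegaBar liftG) X) (c : Sec (liftG.obj natG) X),
      (∀ᶠ n in Filter.atTop, s p n = c) → G X p = c := fun p c hc => by
    obtain ⟨n, h1, h2⟩ := ((hG _ p).and hc).exists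
    exact h1.symm.trans h2
  refine ⟨homOfSec G fun k p => (huniq _ _ ?_).symm, hom_ext_ap fun X p => ?_⟩
  · exact (hG _ p).mono fun n hn => by rw [← hres, hn]
  -- A section of `ω` comes locally from some `Lᵐ 1`, where truncation at `n ≥ m` changes nothing.
  · obtain ⟨a, w, rfl⟩ := exists_pair p
    obtain ⟨S, hS, h⟩ := exists_cover_omegaIn w
    refine sec_ext_of_mem hS fun {Y} k hk => ?_
    obtain ⟨m, d, hd⟩ := h k hk
    rw [res_ap, res_ap, res_pair, ← hd]
    change G Y (pair (res k a) (ap (omegaInclusion liftG botG) (ap (omegaIn m) d))) =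
      ap f (pair (res k a) (ap (omegaIn m) d))
    refine huniq _ _ (Filter.eventually_atTop.2 ⟨m, fun n hn => ?_⟩)
    have e : ap (omegaIn n) (ap (barProj n) (ap (omegaInclusion liftG botG) (ap (omegaIn m) d))) =
        ap (omegaIn m) d := by
      rw [← ap_comp (omegaInclusion liftG botG), ← ap_comp (omegaIn m),
        omegaIn_inclusion_barProj, ← ap_comp, compare_omegaIn hn]
    exact congrArg (fun z => ap f (pair (res k a) z)) e

/-- Extensions along `A × ω ⟶ A × ω̄` are unique: two extensions agree at the finite points of a
suitable section over `V`, hence at `∞`. -/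
theorem extension_unique {A : GTopos} {g g' : A ⊗ omegaBar liftG ⟶ liftG.obj natG}
    (h : (A ◁ omegaInclusion liftG botG) ≫ g = (A ◁ omegaInclusion liftG botG) ≫ g') :
    g = g' := by
  refine hom_ext_ap fun X p => lift_nat_ext fun x => ?_
  rw [res_ap, res_ap]
  obtain ⟨a, u, e⟩ := exists_pair (res (point x) p)
  obtain ⟨v, rfl, hv⟩ := exists_section_vert u
  have key := lift_nat_vert_eq_top (s := ap g (pair (res toStar a) v))
    (s' := ap g' (pair (res toStar a) v)) fun n => by
      obtain ⟨w, hw⟩ := hv n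
      rw [res_ap, res_ap, res_pair, res_vpt_toStar, hw, ← ap_whiskerLeft_pair]
      exact congrArg (fun k => ap k (pair a w)) h
  rwa [res_ap, res_ap, res_pair, res_vpt_toStar, ← e] at key

theorem isComplete_lift_nat : IsComplete liftG botG (liftG.obj natG) := fun A f => by
  obtain ⟨g, hg⟩ := exists_extension f
  exact ⟨g, hg, fun g' hg' => extension_unique (hg'.trans hg.symm)⟩

theorem isGrothendieckTopos_GTopos : IsGrothendieckTopos.{0, 1} GTopos :=
  ⟨SiteObj, inferInstance, SiteObj.cov.toGrothendieck, ⟨CategoryTheory.Equivalence.refl⟩⟩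

end PCFv

theorem mainTheorem6 :
    (PCFv.IsLifting PCFv.trueG PCFv.liftG PCFv.unitG ∧
      PCFv.IsBottom PCFv.unitG PCFv.botG ∧
      PCFv.IsComplete PCFv.liftG PCFv.botG (PCFv.liftG.obj PCFv.natG)) ∧
    PCFv.IsNormalModel.{0, 1} PCFv.trueG := by
  have h := And.intro PCFv.isLifting_liftG
    (And.intro PCFv.isBottom_botG PCFv.isComplete_lift_nat)
  exact ⟨h, PCFv.isGrothendieckTopos_GTopos, PCFv.isGenericSemidecidable_true, _, _, _, h⟩
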